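/- A real number $\beta>1$ is called univoque if there exists a unique sequence of integers $(s_n)_{n\ge 1}$ with $0\le s_n<\beta$ for all $n$ such that $1=\sum_{n\ge 1}s_n\beta^{-n}$. A Pisot number is a real algebraic integer $\beta>1$ all of whose algebraic conjugates other than $\beta$ itself have modulus $<1$. Let $\mathcal U$ be the set of univoque real numbers in the open interval $(1,2)$. Then there exists a smallest Pisot number in $\mathcal U$; that is, the set of Pisot numbers belonging to $\mathcal U$ is non-empty and has a least element. -/

import Mathlib

open Polynomial

/-- A Pisot number: a real algebraic integer `β > 1` all of whose algebraic conjugates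
(complex roots of its minimal polynomial over `ℚ`) other than `β` itself have modulus `< 1`. -/
def IsPisot (β : ℝ) : Prop :=
  1 < β ∧ IsIntegral ℤ β ∧
    ∀ z : ℂ, aeval z (minpoly ℚ β) = 0 → z ≠ (β : ℂ) → ‖z‖ < 1

/-- `s` represents `1` in base `β`: the integer digits satisfy `0 ≤ s n < β` and
`1 = ∑ s n * β ^ (-(n + 1))`. Digits are indexed from `0`: `s n` is the `(n + 1)`-st digit. -/
def RepresentsOne (β : ℝ) (s : ℕ → ℤ) : Prop :=
  (∀ n, 0 ≤ s n ∧ (s n : ℝ) < β) ∧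
    HasSum (fun n : ℕ => (s n : ℝ) / β ^ (n + 1)) 1

/-- A real number `β > 1` is univoque if `1` has exactly one representation in base `β`. -/
def IsUnivoque (β : ℝ) : Prop :=
  1 < β ∧ ∃! s : ℕ → ℤ, RepresentsOne β s

/-- The set of univoque real numbers in the open interval `(1, 2)`. -/
def univoqueSet : Set ℝ :=
  {β | β ∈ Set.Ioo (1 : ℝ) 2 ∧ IsUnivoque β}

/-! Let A be the set of univoque Pisot numbers in (1, 2) and θ its infimum. The root of x⁴ - x³ -
2x² + 1 near 1.905 lies in A, so A is non-empty. Were θ not in A, it would be a limit of elements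
strictly above it. Such a limit is again univoque and Pisot, which is a contradiction.

Univoque limits (`isUnivoque_of_ultrafilter`): β is univoque exactly when the orbit of 1 under y ↦
βy - digit never meets the region where both digits are possible. Along an ultrafilter the digits
stabilise and the strict inequalities survive weakly. Equality at a digit 0 is impossible because
orbits increase with β. Equality at a digit 1 makes the orbit restart as its own reflection, which
produces equality at a digit 0.

Pisot limits (`isPisot_of_ultrafilter`) follow Salem. With P the minimal polynomial of β, the power
series P / P.reverse has integer coefficients u. Blaschke factors of the conjugates are contractive,
so ∑ (u (k+1) - β u k)² is bounded independently of β. After a shift that puts u 0 in a fixed range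
away from 0, these sequences converge along the ultrafilter and the bound passes to θ. Conversely
such a sequence forces θ to be Pisot: its Hankel determinants tend to 0 and, being integers, vanish
eventually; so its generating series is rational (Kronecker), it satisfies a monic integer
recurrence (Fatou), and the conjugates of θ then have modulus below 1. -/

/-! ### Orbits of digit expansions -/

/-- The orbit of `x` under the maps `y ↦ β * y - s k`. -/
def digitOrbit (β : ℝ) (s : ℕ → ℤ) (x : ℝ) : ℕ → ℝ
  | 0 => x
  | k + 1 => β * digitOrbit β s x k - s k

theorem digitOrbit_eq {β : ℝ} (hβ : β ≠ 0) (s : ℕ → ℤ) (x : ℝ) (n : ℕ) :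
    digitOrbit β s x n = β ^ n * (x - ∑ k ∈ Finset.range n, (s k : ℝ) / β ^ (k + 1)) := by
  induction n with
  | zero => simp [digitOrbit]
  | succ n ih =>
    rw [digitOrbit, ih, Finset.sum_range_succ]
    field_simp
    ring

theorem digitOrbit_congr {β x : ℝ} {s t : ℕ → ℤ} {n : ℕ} (h : ∀ k < n, s k = t k) :
    digitOrbit β s x n = digitOrbit β t x n := by
  induction n with
  | zero => rfl
  | succ n ih =>
    rw [digitOrbit, digitOrbit, ih fun k hk => h k (by omega), h n (by omega)]

theorem continuous_digitOrbit (s : ℕ → ℤ) (x : ℝ) (n : ℕ) :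
    Continuous fun β => digitOrbit β s x n := by
  induction n with
  | zero => exact continuous_const
  | succ n ih => exact (continuous_id.mul ih).sub continuous_const

/-- The orbit stays in the interval `[0, 1 / (β - 1)]`, with digits `0` and `1`. -/
def IsAdmissible (β : ℝ) (s : ℕ → ℤ) (x : ℝ) : Prop :=
  (∀ k, s k = 0 ∨ s k = 1) ∧
    ∀ k, 0 ≤ digitOrbit β s x k ∧ (β - 1) * digitOrbit β s x k ≤ 1

/-- The orbit at time n is β ^ n times the remainder after n digits, and a remainder lies between
the all-zeros and the all-ones tail. -/
theorem representsOne_iff {β : ℝ} (h1 : 1 < β) (h2 : β < 2) (s : ℕ → ℤ) :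
    RepresentsOne β s ↔ IsAdmissible β s 1 := by
  have hβ : (0 : ℝ) < β := by linarith
  have key : ∀ n, ∑ k ∈ Finset.range n, (s k : ℝ) / β ^ (k + 1)
      = 1 - digitOrbit β s 1 n / β ^ n := by
    intro n
    rw [digitOrbit_eq hβ.ne']
    field_simp
    ring
  have hpow : Filter.Tendsto (fun n : ℕ => (1 : ℝ) / β ^ n) Filter.atTop (nhds 0) := by
    have := tendsto_pow_atTop_nhds_zero_of_lt_one (inv_nonneg.2 hβ.le) (inv_lt_one_of_one_lt₀ h1)
    simpa [inv_pow] using this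
  constructor
  · rintro ⟨hd, hs⟩
    have hd' : ∀ k, s k = 0 ∨ s k = 1 := by
      intro k
      obtain ⟨ha, hb⟩ := hd k
      have : (s k : ℝ) < 2 := hb.trans h2
      have : s k < 2 := by exact_mod_cast this
      omega
    have hnn : ∀ k, 0 ≤ (s k : ℝ) / β ^ (k + 1) := fun k =>
      div_nonneg (by exact_mod_cast (hd k).1) (by positivity)
    refine ⟨hd', fun n => ⟨?_, ?_⟩⟩
    · have := hs.summable.sum_le_tsum (Finset.range n) (fun k _ => hnn k)
      rw [hs.tsum_eq, key] at this
      have h0 : 0 ≤ digitOrbit β s 1 n / β ^ n := by linarith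
      have := mul_nonneg h0 (pow_pos hβ n).le
      rwa [div_mul_cancel₀ _ (by positivity)] at this
    -- Up to the factor β - 1, `e n` is the remainder minus the all-ones tail; it increases to 0, so
    -- it is never positive.
    · set e : ℕ → ℝ := fun n => ((β - 1) * digitOrbit β s 1 n - 1) / β ^ n with he
      have hmono : Monotone e := by
        refine monotone_nat_of_le_succ fun n => ?_
        have hs1 : (s n : ℝ) ≤ 1 := by rcases hd' n with h | h <;> simp [h]
        simp only [he, digitOrbit]
        rw [div_le_div_iff₀ (by positivity) (by positivity), pow_succ]
        have : 0 ≤ (β - 1) * (1 - s n) * β ^ n :=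
          mul_nonneg (mul_nonneg (by linarith) (by linarith)) (by positivity)
        nlinarith
      have hlim : Filter.Tendsto e Filter.atTop (nhds 0) := by
        have h3 := hs.tendsto_sum_nat
        have h4 : e = fun n => (β - 1) * (1 - ∑ k ∈ Finset.range n, (s k : ℝ) / β ^ (k + 1))
            - 1 / β ^ n := by
          funext n
          rw [key]
          simp only [he]
          ring
        rw [h4]
        simpa using ((h3.const_sub 1).const_mul (β - 1)).sub hpow
      have := hmono.ge_of_tendsto hlim n
      simp only [he] at this
      have := mul_nonpos_of_nonpos_of_nonneg this (pow_pos hβ n).le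
      rw [div_mul_cancel₀ _ (by positivity)] at this
      linarith
  · rintro ⟨hd, ho⟩
    have hnn : ∀ k, (0 : ℝ) ≤ s k ∧ (s k : ℝ) < β := by
      intro k
      rcases hd k with h | h <;> simp [h] <;> linarith
    refine ⟨fun k => ⟨by exact_mod_cast (hnn k).1, (hnn k).2⟩, ?_⟩
    rw [hasSum_iff_tendsto_nat_of_nonneg (fun k => div_nonneg (hnn k).1 (by positivity))]
    simp_rw [key]
    have : Filter.Tendsto (fun n => digitOrbit β s 1 n / β ^ n) Filter.atTop (nhds 0) := by
      refine squeeze_zero (fun n => div_nonneg (ho n).1 (by positivity))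
        (g := fun n => 1 / (β - 1) * (1 / β ^ n)) (fun n => ?_) (by simpa using hpow.const_mul _)
      have : digitOrbit β s 1 n ≤ 1 / (β - 1) := by
        rw [le_div_iff₀ (by linarith), mul_comm]
        exact (ho n).2
      calc digitOrbit β s 1 n / β ^ n ≤ 1 / (β - 1) / β ^ n := by gcongr
        _ = _ := by ring
    simpa using this.const_sub 1

/-- The greedy expansion works: digit 1 is taken whenever it leaves a non-negative remainder. -/
theorem exists_isAdmissible {β : ℝ} (h1 : 1 < β) (h2 : β < 2) {x : ℝ} (hx : 0 ≤ x)
    (hx' : (β - 1) * x ≤ 1) : ∃ s, IsAdmissible β s x := by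
  classical
  set T : ℝ → ℝ := fun y => if 1 ≤ β * y then β * y - 1 else β * y with hT
  set s : ℕ → ℤ := fun k => if 1 ≤ β * T^[k] x then 1 else 0 with hs
  have horb : ∀ k, digitOrbit β s x k = T^[k] x := by
    intro k
    induction k with
    | zero => rfl
    | succ k ih =>
      rw [digitOrbit, ih, Function.iterate_succ_apply']
      simp only [hs, hT]
      split_ifs <;> simp
  refine ⟨s, fun k => ?_, fun k => ?_⟩
  · simp only [hs]
    split_ifs <;> simp
  · rw [horb]
    induction k with
    | zero => exact ⟨hx, hx'⟩
    | succ k ih =>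
      rw [Function.iterate_succ_apply']
      generalize T^[k] x = y at ih
      simp only [hT]
      split_ifs with h
      · exact ⟨by linarith, by nlinarith [ih.2]⟩
      · push Not at h
        exact ⟨mul_nonneg (by linarith) ih.1, by nlinarith [ih.1]⟩

/-- Splices the first n digits of s, the digit d and a greedy tail. Applied to the digit opposite to
s n, it contradicts uniqueness. -/
theorem exists_isAdmissible_with_digit {β : ℝ} (h1 : 1 < β) (h2 : β < 2) {s : ℕ → ℤ} {x : ℝ}
    (hs : IsAdmissible β s x) (n : ℕ) (d : ℤ) (hd : d = 0 ∨ d = 1)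
    (h0 : 0 ≤ β * digitOrbit β s x n - d) (h3 : (β - 1) * (β * digitOrbit β s x n - d) ≤ 1) :
    ∃ t, IsAdmissible β t x ∧ t n = d := by
  obtain ⟨r, hr, hro⟩ := exists_isAdmissible h1 h2 h0 h3
  set t : ℕ → ℤ := fun i => if i < n then s i else if i = n then d else r (i - (n + 1)) with ht
  have hlow : ∀ i ≤ n, digitOrbit β t x i = digitOrbit β s x i := fun i hi =>
    digitOrbit_congr fun k hk => by simp [ht, show k < n by omega]
  have hhigh : ∀ i, digitOrbit β t x (n + 1 + i)
      = digitOrbit β r (β * digitOrbit β s x n - d) i := by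
    intro i
    induction i with
    | zero =>
      have htn : t n = d := by simp [ht]
      rw [add_zero, digitOrbit, digitOrbit, hlow n le_rfl, htn]
    | succ i ih =>
      rw [← add_assoc, digitOrbit, ih, digitOrbit]
      simp [ht, show ¬ n + 1 + i < n by omega, show n + 1 + i ≠ n by omega]
  refine ⟨t, ⟨fun k => ?_, fun k => ?_⟩, by simp [ht]⟩
  · simp only [ht]
    split_ifs
    exacts [hs.1 k, hd, hr _]
  · rcases le_or_gt k n with h | h
    · rw [hlow k h]
      exact hs.2 k
    · obtain ⟨i, rfl⟩ := Nat.exists_eq_add_of_lt h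
      rw [show n + i + 1 = n + 1 + i by ring, hhigh]
      exact hro i

/-- The orbit avoids the region where both digits would be possible. -/
def AvoidsSwitch (β : ℝ) (s : ℕ → ℤ) : Prop :=
  ∀ k, (s k = 0 → β * digitOrbit β s 1 k < 1) ∧
    (s k = 1 → 1 < (β - 1) * (β * digitOrbit β s 1 k))

theorem IsUnivoque.avoidsSwitch {β : ℝ} (h2 : β < 2) (hU : IsUnivoque β) {s : ℕ → ℤ}
    (hs : IsAdmissible β s 1) : AvoidsSwitch β s := by
  obtain ⟨h1, s₀, -, huniq⟩ := id hU
  have huniq : ∀ t, IsAdmissible β t 1 → t = s := fun t ht =>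
    (huniq t ((representsOne_iff h1 h2 t).2 ht)).trans
      (huniq s ((representsOne_iff h1 h2 s).2 hs)).symm
  intro k
  have hk := hs.2 k
  have hk1 := hs.2 (k + 1)
  rw [digitOrbit] at hk1
  refine ⟨fun h => ?_, fun h => ?_⟩
  · by_contra! hc
    rw [h] at hk1
    obtain ⟨t, ht, htk⟩ := exists_isAdmissible_with_digit h1 h2 hs k 1 (Or.inr rfl)
      (by push_cast; linarith) (by push_cast at *; nlinarith [hk1.2])
    rw [huniq t ht, h] at htk
    omega
  · by_contra! hc
    obtain ⟨t, ht, htk⟩ := exists_isAdmissible_with_digit h1 h2 hs k 0 (Or.inl rfl)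
      (by push_cast; nlinarith [hk.1]) (by push_cast; linarith)
    rw [huniq t ht, h] at htk
    omega

theorem AvoidsSwitch.isUnivoque {β : ℝ} (h1 : 1 < β) (h2 : β < 2) {s : ℕ → ℤ}
    (hs : IsAdmissible β s 1) (ha : AvoidsSwitch β s) : IsUnivoque β := by
  refine ⟨h1, s, (representsOne_iff h1 h2 s).2 hs, fun t ht => ?_⟩
  replace ht := (representsOne_iff h1 h2 t).1 ht
  funext n
  induction n using Nat.strong_induction_on with
  | _ n ih =>
    have hx : digitOrbit β t 1 n = digitOrbit β s 1 n := digitOrbit_congr ih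
    have h3 := ht.2 (n + 1)
    rw [digitOrbit, hx] at h3
    rcases hs.1 n with h | h <;> rcases ht.1 n with h' | h'
    · rw [h, h']
    · have := (ha n).1 h
      rw [h'] at h3
      push_cast at h3
      linarith [h3.1]
    · have := (ha n).2 h
      rw [h'] at h3
      push_cast at h3
      linarith [h3.2]
    · rw [h, h']

theorem one_lt_of_mem_univoqueSet {β : ℝ} (hβ : β ∈ univoqueSet) : 1 < (β - 1) * β := by
  obtain ⟨⟨h1, h2⟩, hU⟩ := hβ
  obtain ⟨-, s, hs, -⟩ := id hU
  replace hs := (representsOne_iff h1 h2 s).1 hs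
  have ha := hU.avoidsSwitch h2 hs 0
  simp only [digitOrbit, mul_one] at ha
  rcases hs.1 0 with h | h
  · linarith [ha.1 h]
  · exact ha.2 h

/-! ### Limits from the right of univoque numbers -/

theorem digitOrbit_le_digitOrbit {θ β x : ℝ} {s : ℕ → ℤ} (hβ : 0 ≤ β) (h : θ ≤ β)
    (h0 : ∀ k, 0 ≤ digitOrbit θ s x k) (n : ℕ) : digitOrbit θ s x n ≤ digitOrbit β s x n := by
  induction n with
  | zero => rfl
  | succ n ih =>
    rw [digitOrbit, digitOrbit]
    exact sub_le_sub_right (mul_le_mul h ih (h0 n) hβ) _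

/-- If the digit at time `k` is forced only weakly from above, the orbit restarts as the
reflection of itself. -/
theorem digitOrbit_reflect {θ : ℝ} (h1 : 1 < θ) (h2 : θ < 2) {s : ℕ → ℤ}
    (hd : ∀ k, s k = 0 ∨ s k = 1) (hlow : ∀ k, s k = 0 → θ * digitOrbit θ s 1 k ≤ 1)
    (hhigh : ∀ k, s k = 1 → 1 ≤ (θ - 1) * (θ * digitOrbit θ s 1 k)) {k : ℕ} (hk : s k = 1)
    (hx : (θ - 1) * (θ * digitOrbit θ s 1 k) = 1) (i : ℕ) :
    (θ - 1) * digitOrbit θ s 1 (k + 1 + i) = 1 - (θ - 1) * digitOrbit θ s 1 i ∧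
      s (k + 1 + i) = 1 - s i := by
  -- Equal digits at a point and at its reflection would, on adding their two inequalities, give θ ≥
  -- 2.
  have step : ∀ i, (θ - 1) * digitOrbit θ s 1 (k + 1 + i) = 1 - (θ - 1) * digitOrbit θ s 1 i →
      s (k + 1 + i) = 1 - s i := by
    intro i hi
    rcases hd i with h | h <;> rcases hd (k + 1 + i) with h' | h'
    · have ha := hlow i h
      have hb := hlow _ h'
      nlinarith
    · rw [h, h']; rfl
    · rw [h, h']; rfl
    · have ha := hhigh i h
      have hb := hhigh _ h'
      nlinarith
  have main : (θ - 1) * digitOrbit θ s 1 (k + 1 + i) = 1 - (θ - 1) * digitOrbit θ s 1 i := by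
    induction i with
    | zero =>
      simp only [digitOrbit, hk]
      push_cast
      linarith
    | succ i ih =>
      rw [← add_assoc, digitOrbit, digitOrbit, step i ih]
      push_cast
      linear_combination θ * ih
  exact ⟨main, step i main⟩

/-- This replaces diagonal extraction: bounded integer data become constant along an ultrafilter. -/
theorem Ultrafilter.exists_eventually_eq_of_bounded {α : Type*} (F : Ultrafilter α) (f : α → ℤ)
    (B : ℤ) (h : ∀ᶠ a in F, |f a| ≤ B) : ∃ d, ∀ᶠ a in F, f a = d := by
  have := (Ultrafilter.eventually_exists_mem_iff (f := F) (P := fun d a => f a = d)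
    (Set.finite_Icc (-B) B)).1 (h.mono fun a ha => ⟨f a, abs_le.1 ha, rfl⟩)
  obtain ⟨d, -, hd⟩ := this
  exact ⟨d, hd⟩

theorem isUnivoque_of_ultrafilter {θ : ℝ} (h1 : 1 < θ) (h2 : θ < 2) (F : Ultrafilter ℝ)
    (hF : (F : Filter ℝ) ≤ nhds θ) (hgt : ∀ᶠ β in F, θ < β) (hU : ∀ᶠ β in F, β ∈ univoqueSet) :
    IsUnivoque θ := by
  have hex : ∀ β : ℝ, ∃ s : ℕ → ℤ, β ∈ univoqueSet → IsAdmissible β s 1 ∧ AvoidsSwitch β s := by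
    intro β
    by_cases h : β ∈ univoqueSet
    · obtain ⟨s, hs, -⟩ := h.2.2
      have hs' := (representsOne_iff h.1.1 h.1.2 s).1 hs
      exact ⟨s, fun _ => ⟨hs', h.2.avoidsSwitch h.1.2 hs'⟩⟩
    · exact ⟨0, fun h' => absurd h' h⟩
  choose s hs using hex
  have hlim : ∀ k, ∃ d, ∀ᶠ β in F, s β k = d := fun k =>
    F.exists_eventually_eq_of_bounded _ 1 <| hU.mono fun β hβ => by
      rcases (hs β hβ).1.1 k with h | h <;> simp [h]
  choose d hdF using hlim
  have hall : ∀ n, ∀ᶠ β in F, ∀ k < n, s β k = d k := fun n =>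
    (Filter.eventually_all_finite (Set.finite_Iio n)).2 fun k _ => hdF k
  have horb : ∀ n, ∀ᶠ β in F, digitOrbit β (s β) 1 n = digitOrbit β d 1 n := fun n =>
    (hall n).mono fun β hβ => digitOrbit_congr hβ
  have htend : ∀ n, Filter.Tendsto (fun β => digitOrbit β d 1 n) F
      (nhds (digitOrbit θ d 1 n)) := fun n =>
    ((continuous_digitOrbit d 1 n).tendsto θ).mono_left hF
  have hid : Filter.Tendsto (fun β : ℝ => β) F (nhds θ) := hF
  have hd : ∀ k, d k = 0 ∨ d k = 1 := fun k => by
    obtain ⟨β, hβ, hβ'⟩ := (hU.and (hdF k)).exists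
    rw [← hβ']
    exact (hs β hβ).1.1 k
  have hadm : IsAdmissible θ d 1 := by
    refine ⟨hd, fun k => ⟨?_, ?_⟩⟩
    · refine ge_of_tendsto (htend k) ?_
      filter_upwards [hU, horb k] with β hβ ho
      rw [← ho]
      exact ((hs β hβ).1.2 k).1
    · refine le_of_tendsto ((hid.sub_const 1).mul (htend k)) ?_
      filter_upwards [hU, horb k] with β hβ ho
      rw [← ho]
      exact ((hs β hβ).1.2 k).2
  have hlow : ∀ k, d k = 0 → θ * digitOrbit θ d 1 k ≤ 1 := fun k hk => by
    refine le_of_tendsto (hid.mul (htend k)) ?_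
    filter_upwards [hU, horb k, hdF k] with β hβ ho hdk
    rw [← ho]
    exact (((hs β hβ).2 k).1 (hdk.trans hk)).le
  have hhigh : ∀ k, d k = 1 → 1 ≤ (θ - 1) * (θ * digitOrbit θ d 1 k) := fun k hk => by
    refine ge_of_tendsto ((hid.sub_const 1).mul (hid.mul (htend k))) ?_
    filter_upwards [hU, horb k, hdF k] with β hβ ho hdk
    rw [← ho]
    exact (((hs β hβ).2 k).2 (hdk.trans hk)).le
  have hne : ∀ k, d k = 0 → θ * digitOrbit θ d 1 k ≠ 1 := by
    intro k hk hx
    -- For β > θ with the same digits up to time k, the orbit is at least that of θ, so β times it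
    -- exceeds 1 although the digit is 0.
    obtain ⟨β, hβ, ho, hdk, hlt⟩ := (hU.and ((horb k).and ((hdF k).and hgt))).exists
    have h3 := ((hs β hβ).2 k).1 (hdk.trans hk)
    rw [ho] at h3
    have h4 := digitOrbit_le_digitOrbit (by linarith : 0 ≤ β) hlt.le
      (fun k => (hadm.2 k).1) k
    have h5 : 0 < digitOrbit θ d 1 k := by
      rcases (hadm.2 k).1.lt_or_eq with h | h
      · exact h
      · rw [← h] at hx; simp at hx
    nlinarith
  refine AvoidsSwitch.isUnivoque h1 h2 hadm fun k => ⟨fun hk => (hlow k hk).lt_of_ne (hne k hk),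
    fun hk => (hhigh k hk).lt_of_ne' fun hx => ?_⟩
  -- Monotonicity in β does not exclude equality at a digit 1. Reflecting time k itself gives time k
  -- + 1 + k, where the digit is 0 and equality holds.
  obtain ⟨h3, h4⟩ := digitOrbit_reflect h1 h2 hd hlow hhigh hk hx k
  refine hne (k + 1 + k) (by rw [h4, hk]; rfl) ?_
  have h5 : (θ - 1) * (θ * digitOrbit θ d 1 (k + 1 + k)) = (θ - 1) * 1 := by
    linear_combination θ * h3 - hx
  exact mul_left_cancel₀ (by linarith) h5

/-! ### Blaschke factors acting on power series -/

/-- On the unit circle the two factors have equal modulus. For truncated sums the defect is exactly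
(1 - ‖a‖²) times the squared norm of the last coefficient of w involved. -/
theorem sum_norm_sq_X_sub_C_mul_le {a : ℂ} (ha : ‖a‖ ≤ 1) (w : PowerSeries ℂ) (n : ℕ) :
    ∑ k ∈ Finset.range n, ‖PowerSeries.coeff k ((PowerSeries.X - PowerSeries.C a) * w)‖ ^ 2 ≤
      ∑ k ∈ Finset.range n,
        ‖PowerSeries.coeff k ((1 - PowerSeries.C (star a) * PowerSeries.X) * w)‖ ^ 2 := by
  have h1 : 0 ≤ 1 - ‖a‖ ^ 2 := by nlinarith [norm_nonneg a]
  rcases n with _ | n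
  · simp
  suffices h : ∑ k ∈ Finset.range (n + 1),
      ‖PowerSeries.coeff k ((PowerSeries.X - PowerSeries.C a) * w)‖ ^ 2 +
        (1 - ‖a‖ ^ 2) * ‖PowerSeries.coeff n w‖ ^ 2 = ∑ k ∈ Finset.range (n + 1),
        ‖PowerSeries.coeff k ((1 - PowerSeries.C (star a) * PowerSeries.X) * w)‖ ^ 2 by
    rw [← h]
    have : 0 ≤ (1 - ‖a‖ ^ 2) * ‖PowerSeries.coeff n w‖ ^ 2 := by positivity
    linarith
  induction n with
  | zero =>
    simp only [zero_add, Finset.sum_range_one, sub_mul, map_sub, PowerSeries.coeff_C_mul, one_mul,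
      mul_assoc, PowerSeries.coeff_zero_X_mul, mul_zero, sub_zero, zero_sub, norm_neg, norm_mul]
    ring
  | succ n ih =>
    rw [Finset.sum_range_succ, Finset.sum_range_succ _ (n + 1), ← ih]
    simp only [sub_mul, map_sub, PowerSeries.coeff_C_mul, one_mul,
      mul_assoc, PowerSeries.coeff_succ_X_mul]
    simp only [← Complex.normSq_eq_norm_sq, Complex.normSq_apply, Complex.sub_re, Complex.sub_im,
      Complex.mul_re, Complex.mul_im, Complex.star_def, Complex.conj_re, Complex.conj_im]
    ring

theorem sum_norm_sq_prod_X_sub_C_mul_le (R : Multiset ℂ) (hR : ∀ a ∈ R, ‖a‖ ≤ 1)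
    (w : PowerSeries ℂ) (n : ℕ) :
    ∑ k ∈ Finset.range n,
        ‖PowerSeries.coeff k ((R.map fun a => PowerSeries.X - PowerSeries.C a).prod * w)‖ ^ 2 ≤
      ∑ k ∈ Finset.range n, ‖PowerSeries.coeff k
        ((R.map fun a => 1 - PowerSeries.C (star a) * PowerSeries.X).prod * w)‖ ^ 2 := by
  induction R using Multiset.induction_on generalizing w with
  | empty => simp
  | cons a R ih =>
    simp only [Multiset.map_cons, Multiset.prod_cons]
    have h1 := sum_norm_sq_X_sub_C_mul_le (hR a (Multiset.mem_cons_self a R))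
      ((R.map fun a => PowerSeries.X - PowerSeries.C a).prod * w) n
    have h2 := ih (fun b hb => hR b (Multiset.mem_cons_of_mem hb))
      ((1 - PowerSeries.C (star a) * PowerSeries.X) * w)
    rw [mul_assoc]
    refine h1.trans (le_of_eq_of_le ?_ (h2.trans_eq ?_))
    · refine Finset.sum_congr rfl fun k _ => ?_
      rw [mul_left_comm]
    · refine Finset.sum_congr rfl fun k _ => ?_
      congr 3
      ring

/-! ### Integer sequences attached to Pisot numbers -/

theorem Polynomial.reverse_prod_X_sub_C (R : Multiset ℂ) :
    (R.map fun a => X - C a).prod.reverse = (R.map fun a => 1 - C a * X).prod := by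
  induction R using Multiset.induction_on with
  | empty => simpa using (reverse_C (1 : ℂ))
  | cons a R ih =>
    simp only [Multiset.map_cons, Multiset.prod_cons]
    rw [reverse_mul_of_domain, ih]
    congr 1
    have h : (X - C a : ℂ[X]) = X + C (-a) := by simp [sub_eq_add_neg]
    rw [h, reverse, natDegree_X_add_C, reflect_add, reflect_C]
    have : reflect 1 (X : ℂ[X]) = 1 := by
      simp
    rw [this]
    simp [sub_eq_add_neg]

/-- The complex roots of the minimal polynomial of a Pisot number. -/
theorem IsPisot.exists_roots {θ : ℝ} (h : IsPisot θ) :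
    ∃ R : Multiset ℂ, R.Nodup ∧ (∀ a ∈ R, ‖a‖ < 1) ∧
      (minpoly ℤ θ).map (Int.castRingHom ℂ) = ((θ : ℂ) ::ₘ R |>.map fun a => X - C a).prod := by
  obtain ⟨h1, hint, hconj⟩ := h
  set p := minpoly ℚ θ with hp
  have hpZ : p = (minpoly ℤ θ).map (algebraMap ℤ ℚ) :=
    minpoly.isIntegrallyClosed_eq_field_fractions' ℚ hint
  have hmap : (minpoly ℤ θ).map (Int.castRingHom ℂ) = p.map (algebraMap ℚ ℂ) := by
    rw [hpZ, Polynomial.map_map]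
    congr 1
  have hintQ : IsIntegral ℚ θ := hint.tower_top
  have hmonic : (p.map (algebraMap ℚ ℂ)).Monic := (minpoly.monic hintQ).map _
  have hsplit := (IsAlgClosed.splits (p.map (algebraMap ℚ ℂ))).eq_prod_roots_of_monic hmonic
  have hnodup : (p.map (algebraMap ℚ ℂ)).roots.Nodup :=
    nodup_roots ((minpoly.irreducible hintQ).separable.map)
  have hroot : aeval (θ : ℂ) p = 0 := by
    have h := congrArg (algebraMap ℝ ℂ) (minpoly.aeval ℚ θ)
    rw [map_zero, ← Polynomial.aeval_algebraMap_apply] at h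
    exact h
  have hmem : (θ : ℂ) ∈ (p.map (algebraMap ℚ ℂ)).roots := by
    rw [mem_roots hmonic.ne_zero, IsRoot.def, eval_map_algebraMap]
    exact hroot
  obtain ⟨R, hR⟩ := Multiset.exists_cons_of_mem hmem
  rw [hR] at hnodup hsplit
  rw [Multiset.nodup_cons] at hnodup
  refine ⟨R, hnodup.2, fun a ha => hconj a ?_ ?_, by rw [hmap, hsplit]⟩
  · have : a ∈ (p.map (algebraMap ℚ ℂ)).roots := hR ▸ Multiset.mem_cons_of_mem ha
    rw [mem_roots hmonic.ne_zero, IsRoot.def, eval_map_algebraMap] at this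
    exact this
  · rintro rfl
    exact hnodup.1 ha

/-- A reciprocal quotient `P / P.reverse` is not a polynomial when `1 < θ < 2`. -/
theorem IsPisot.minpoly_ne_reverse_mul {θ : ℝ} (h : IsPisot θ) (h2 : θ < 2) (f : ℤ[X]) :
    (minpoly ℤ θ).reverse * f ≠ minpoly ℤ θ := by
  intro hf
  have h1 := h.1
  obtain ⟨R, hnodup, hR, hP⟩ := h.exists_roots
  have hθ0 : (θ : ℂ) ≠ 0 := by
    exact_mod_cast (by linarith : θ ≠ 0)
  have heval : ∀ z : ℂ, (minpoly ℤ θ).eval₂ (Int.castRingHom ℂ) z = 0 ↔ z = θ ∨ z ∈ R := by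
    intro z
    rw [eval₂_eq_eval_map, hP, eval_multiset_prod, Multiset.prod_eq_zero_iff]
    simp [sub_eq_zero, eq_comm]
  have hinv : ∀ z : ℂ, z ≠ 0 → (z = θ ∨ z ∈ R) → (z⁻¹ = θ ∨ z⁻¹ ∈ R) := by
    intro z hz hzr
    let _ := invertibleOfNonzero hz
    rw [← heval] at hzr ⊢
    have h3 := (eval₂_reverse_eq_zero_iff (Int.castRingHom ℂ) z (minpoly ℤ θ)).2 hzr
    rw [← hf, eval₂_mul]
    rw [invOf_eq_inv] at h3
    rw [h3, zero_mul]
  have hnθ : (θ : ℂ)⁻¹ ≠ θ := by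
    intro h3
    have h4 : (θ : ℂ) * θ = 1 := by
      nth_rewrite 1 [← h3]
      exact inv_mul_cancel₀ hθ0
    have h5 : θ * θ = 1 := by exact_mod_cast h4
    nlinarith
  have hθR : (θ : ℂ)⁻¹ ∈ R := (hinv θ hθ0 (Or.inl rfl)).resolve_left hnθ
  have h0R : (0 : ℂ) ∉ R := by
    intro h3
    have h5 : (minpoly ℤ θ).coeff 0 = 0 := by
      have h6 := (heval 0).2 (Or.inr h3)
      rw [eval₂_at_zero] at h6
      simpa using h6
    have h6 : (minpoly ℚ θ).coeff 0 = 0 := by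
      rw [minpoly.isIntegrallyClosed_eq_field_fractions' ℚ h.2.1, coeff_map, h5, map_zero]
    exact minpoly.coeff_zero_ne_zero h.2.1.tower_top (by linarith : θ ≠ 0) h6
  -- The roots are closed under inversion, and only θ lies outside the open disc.
  have hall : ∀ a ∈ R, a = (θ : ℂ)⁻¹ := by
    intro a ha
    have ha0 : a ≠ 0 := fun h3 => h0R (h3 ▸ ha)
    rcases hinv a ha0 (Or.inr ha) with h3 | h3
    · rw [← h3, inv_inv]
    · have h4 := hR _ h3
      have h5 := hR a ha
      rw [norm_inv] at h4
      exact absurd h4 (not_lt.2 ((one_le_inv₀ (norm_pos_iff.2 ha0)).2 h5.le))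
  have hRs : R = {(θ : ℂ)⁻¹} := by
    obtain ⟨S, hS⟩ := Multiset.exists_cons_of_mem hθR
    rcases S.empty_or_exists_mem with rfl | ⟨b, hb⟩
    · exact hS
    · have h3 := hall b (hS ▸ Multiset.mem_cons_of_mem hb)
      rw [hS, Multiset.nodup_cons] at hnodup
      exact absurd (h3 ▸ hb) hnodup.1
  have hc := congrArg (fun p : ℂ[X] => p.coeff 1) hP
  simp only [hRs, coeff_map, eq_intCast, Multiset.map_cons, Multiset.map_singleton,
    Multiset.prod_cons, Multiset.prod_singleton] at hc
  have hexp : ((X - C (θ : ℂ)) * (X - C (θ : ℂ)⁻¹) : ℂ[X]).coeff 1 = -(θ + (θ : ℂ)⁻¹) := by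
    have : ((X - C (θ : ℂ)) * (X - C (θ : ℂ)⁻¹) : ℂ[X])
        = X ^ 2 - C (θ + (θ : ℂ)⁻¹) * X + C ((θ : ℂ) * (θ : ℂ)⁻¹) := by
      rw [C_add, C_mul]; ring
    rw [this]
    simp [coeff_X_pow, coeff_C]
  rw [hexp] at hc
  set m := (minpoly ℤ θ).coeff 1
  have hc' : (m : ℝ) = -(θ + θ⁻¹) := by exact_mod_cast hc
  have h3 : θ * θ⁻¹ = 1 := mul_inv_cancel₀ (by linarith)
  have h4 : 0 < θ⁻¹ := by positivity
  have h5 : θ⁻¹ < 1 := inv_lt_one_of_one_lt₀ h1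
  -- The trace θ + θ⁻¹ of the remaining quadratic would be an integer strictly between 2 and 3.
  have h6 : (-3 : ℝ) < m := by rw [hc']; linarith
  have h7 : (m : ℝ) < -2 := by
    rw [hc']
    nlinarith [mul_pos (sub_pos.2 h1) (sub_pos.2 h5)]
  have h8 : -3 < m := by exact_mod_cast h6
  have h9 : m < -2 := by exact_mod_cast h7
  omega

/-- The sequence is the coefficients of P / P.reverse. Multiplying by 1 - θX removes the pole at 1/θ
and leaves X - θ times a Blaschke product, whose ℓ² norm is at most that of X - θ; hence 1 + θ². A
sequence vanishing from some index on would make the quotient a polynomial. -/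
theorem IsPisot.exists_seq {θ : ℝ} (h : IsPisot θ) (h2 : θ < 2) :
    ∃ u : ℕ → ℤ, (∀ n, (u 0 : ℝ) ^ 2 + ∑ k ∈ Finset.range n, ((u (k + 1) : ℝ) - θ * u k) ^ 2 ≤
      1 + θ ^ 2) ∧ ∀ K, ∃ k ≥ K, u k ≠ 0 := by
  obtain ⟨R, hnodup, hR, hP⟩ := h.exists_roots
  set P := minpoly ℤ θ with hPdef
  have hPm : P.Monic := minpoly.monic h.2.1
  have hQ0 : PowerSeries.constantCoeff (P.reverse : PowerSeries ℤ) = ((1 : ℤˣ) : ℤ) := by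
    rw [← PowerSeries.coeff_zero_eq_constantCoeff_apply, coeff_coe, coeff_zero_reverse,
      hPm.leadingCoeff]
    rfl
  set f : PowerSeries ℤ := PowerSeries.invOfUnit (P.reverse : PowerSeries ℤ) 1 * P with hf
  have hQf : (P.reverse : PowerSeries ℤ) * f = P := by
    rw [hf, ← mul_assoc, PowerSeries.mul_invOfUnit _ _ hQ0, one_mul]
  refine ⟨fun k => PowerSeries.coeff k f, fun n => ?_, fun K => ?_⟩
  · set B : PowerSeries ℂ := (R.map fun a => PowerSeries.X - PowerSeries.C a).prod with hB
    set D : PowerSeries ℂ :=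
      (R.map fun a => 1 - PowerSeries.C (star a) * PowerSeries.X).prod with hD
    set g : PowerSeries ℂ := PowerSeries.map (Int.castRingHom ℂ) f with hg
    have hPc : ((P.map (Int.castRingHom ℂ) : ℂ[X]) : PowerSeries ℂ)
        = (PowerSeries.X - PowerSeries.C (θ : ℂ)) * B := by
      rw [hP, Multiset.map_cons, Multiset.prod_cons, Polynomial.coe_mul, hB]
      congr 1
      · simp
      · rw [← Polynomial.coeToPowerSeries.ringHom_apply, map_multiset_prod, Multiset.map_map]
        simp [Function.comp_def]
    have hQc : ((P.reverse.map (Int.castRingHom ℂ) : ℂ[X]) : PowerSeries ℂ)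
        = (1 - PowerSeries.C (θ : ℂ) * PowerSeries.X) * D := by
      have h3 : P.reverse.map (Int.castRingHom ℂ)
          = ((θ : ℂ) ::ₘ R |>.map fun a => 1 - C a * X).prod := by
        rw [← reverse_prod_X_sub_C, ← hP, reverse, reverse, reflect_map, hPm.natDegree_map]
      -- P has integer coefficients, so conjugating all the roots changes nothing; this produces the
      -- conjugates in the Blaschke denominators.
      have h4 : P.reverse.map (Int.castRingHom ℂ)
          = ((θ : ℂ) ::ₘ R |>.map fun a => 1 - C (star a) * X).prod := by
        have h5 : (P.reverse.map (Int.castRingHom ℂ)).map (starRingEnd ℂ)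
            = P.reverse.map (Int.castRingHom ℂ) := by
          rw [Polynomial.map_map]
          congr 1
          exact RingHom.ext_int _ _
        rw [← h5, h3, Polynomial.map_multiset_prod, Multiset.map_map]
        simp
      rw [h4, Multiset.map_cons, Multiset.prod_cons, Polynomial.coe_mul, hD]
      congr 1
      · simp
      · rw [← Polynomial.coeToPowerSeries.ringHom_apply, map_multiset_prod, Multiset.map_map]
        simp [Function.comp_def]
    have hmain : (1 - PowerSeries.C (θ : ℂ) * PowerSeries.X) * D * g
        = (PowerSeries.X - PowerSeries.C (θ : ℂ)) * B := by
      rw [← hQc, ← hPc, Polynomial.polynomial_map_coe, Polynomial.polynomial_map_coe, hg,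
        ← map_mul, hQf]
    have hD0 : PowerSeries.constantCoeff D ≠ 0 := by
      rw [hD, map_multiset_prod, Multiset.map_map]
      simp
    have hDne : D ≠ 0 := fun h3 => hD0 (by rw [h3, map_zero])
    have hfac : B * (D⁻¹ * (PowerSeries.X - PowerSeries.C (θ : ℂ)))
        = (1 - PowerSeries.C (θ : ℂ) * PowerSeries.X) * g := by
      refine mul_left_cancel₀ hDne ?_
      calc D * (B * (D⁻¹ * (PowerSeries.X - PowerSeries.C (θ : ℂ))))
          = (D * D⁻¹) * ((PowerSeries.X - PowerSeries.C (θ : ℂ)) * B) := by ring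
        _ = (1 - PowerSeries.C (θ : ℂ) * PowerSeries.X) * D * g := by
            rw [PowerSeries.mul_inv_cancel _ hD0, one_mul, hmain]
        _ = _ := by ring
    have hle := sum_norm_sq_prod_X_sub_C_mul_le R (fun a ha => (hR a ha).le)
      (D⁻¹ * (PowerSeries.X - PowerSeries.C (θ : ℂ))) (n + 1)
    rw [← hB, ← hD, hfac, ← mul_assoc, PowerSeries.mul_inv_cancel _ hD0, one_mul,
      Finset.sum_range_succ', Finset.sum_range_succ'] at hle
    have hrhs : ∑ k ∈ Finset.range n, ‖PowerSeries.coeff (k + 1)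
        (PowerSeries.X - PowerSeries.C (θ : ℂ))‖ ^ 2 ≤ 1 := by
      have : ∀ k, ‖PowerSeries.coeff (k + 1) (PowerSeries.X - PowerSeries.C (θ : ℂ))‖ ^ 2
          = if k = 0 then 1 else 0 := by
        intro k
        rw [map_sub, PowerSeries.coeff_X, PowerSeries.coeff_C]
        split_ifs <;> simp_all
      simp_rw [this]
      rw [Finset.sum_ite_eq']
      split_ifs <;> norm_num
    have h0 : PowerSeries.coeff 0 ((1 - PowerSeries.C (θ : ℂ) * PowerSeries.X) * g)
        = ((PowerSeries.coeff 0 f : ℤ) : ℂ) := by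
      simp only [sub_mul, mul_assoc, one_mul, map_sub, PowerSeries.coeff_C_mul,
        PowerSeries.coeff_zero_X_mul, hg, PowerSeries.coeff_map, mul_zero, sub_zero, eq_intCast]
    have hk : ∀ k, PowerSeries.coeff (k + 1) ((1 - PowerSeries.C (θ : ℂ) * PowerSeries.X) * g)
        = (((PowerSeries.coeff (k + 1) f : ℤ) - θ * (PowerSeries.coeff k f : ℤ) : ℝ) : ℂ) := by
      intro k
      simp only [sub_mul, mul_assoc, one_mul, map_sub, PowerSeries.coeff_C_mul,
        PowerSeries.coeff_succ_X_mul, hg, PowerSeries.coeff_map]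
      push_cast
      simp
    simp only [h0, hk, Complex.norm_real, Real.norm_eq_abs, sq_abs, Complex.norm_intCast] at hle
    have h3 : ‖PowerSeries.coeff 0 (PowerSeries.X - PowerSeries.C (θ : ℂ))‖ ^ 2 = θ ^ 2 := by
      simp
    rw [h3] at hle
    linarith
  · by_contra! hK
    refine h.minpoly_ne_reverse_mul h2 (f.trunc K) ?_
    have htr : ((f.trunc K : ℤ[X]) : PowerSeries ℤ) = f := by
      ext k
      rw [coeff_coe, PowerSeries.coeff_trunc]
      split_ifs with h3
      · rfl
      · exact (hK k (by omega)).symm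
    apply Polynomial.coe_injective ℤ
    rw [Polynomial.coe_mul, htr, hQf]

/-- The shift goes to the first term of size at least 12, so that limits stay non-degenerate. Since
1 + θ² ≤ 5, each error is at most 3, and the previous term is below 12: hence 27 = 2 · 12 + 3. -/
theorem IsPisot.exists_seq_large {θ : ℝ} (h : IsPisot θ) (h1 : 3 / 2 ≤ θ) (h2 : θ < 2) :
    ∃ u : ℕ → ℤ, 12 ≤ |u 0| ∧ |u 0| ≤ 27 ∧
      ∀ n, ∑ k ∈ Finset.range n, ((u (k + 1) : ℝ) - θ * u k) ^ 2 ≤ 5 := by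
  obtain ⟨u, hu, hne⟩ := h.exists_seq h2
  have hb : ∀ n, ∑ k ∈ Finset.range n, ((u (k + 1) : ℝ) - θ * u k) ^ 2 ≤ 5 := fun n => by
    nlinarith [hu n, sq_nonneg (u 0 : ℝ)]
  have hsum : Summable fun k => ((u (k + 1) : ℝ) - θ * u k) ^ 2 :=
    summable_of_sum_range_le (fun _ => sq_nonneg _) hb
  have hterm : ∀ k, |(u (k + 1) : ℝ) - θ * u k| ≤ 3 := fun k => by
    have h3 := hb (k + 1)
    rw [Finset.sum_range_succ] at h3
    have h4 : 0 ≤ ∑ k ∈ Finset.range k, ((u (k + 1) : ℝ) - θ * u k) ^ 2 :=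
      Finset.sum_nonneg fun _ _ => sq_nonneg _
    exact abs_le_of_sq_le_sq (by linarith) (by norm_num)
  have hlarge : ∃ m, 12 ≤ |u m| := by
    have hev := hsum.tendsto_atTop_zero.eventually (gt_mem_nhds (by norm_num : (0 : ℝ) < 1 / 16))
    obtain ⟨K, hK⟩ := Filter.eventually_atTop.1 hev
    obtain ⟨k, hkK, hk⟩ := hne K
    -- Once errors are at most 1/4, a non-zero integer term grows by a factor of at least 3/2 - 1/4
    -- = 5/4.
    have hgrow : ∀ i : ℕ, (5 / 4 : ℝ) ^ i ≤ |(u (k + i) : ℝ)| := by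
      intro i
      induction i with
      | zero =>
        have : 1 ≤ |u k| := Int.one_le_abs hk
        simpa using (by exact_mod_cast this : (1 : ℝ) ≤ |(u k : ℝ)|)
      | succ i ih =>
        have h3 : |(u (k + i + 1) : ℝ) - θ * u (k + i)| ≤ 1 / 4 :=
          abs_le_of_sq_le_sq (by linarith [hK (k + i) (by omega)]) (by norm_num)
        have h4 : |θ * (u (k + i) : ℝ)| = θ * |(u (k + i) : ℝ)| := by
          rw [abs_mul, abs_of_nonneg (by linarith)]
        have h5 := abs_sub_abs_le_abs_sub (θ * (u (k + i) : ℝ)) (u (k + i + 1))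
        rw [abs_sub_comm] at h5
        have h6 : (1 : ℝ) ≤ (5 / 4) ^ i := one_le_pow₀ (by norm_num)
        rw [← add_assoc, pow_succ]
        nlinarith
    obtain ⟨i, hi⟩ := pow_unbounded_of_one_lt (12 : ℝ) (by norm_num : (1 : ℝ) < 5 / 4)
    refine ⟨k + i, ?_⟩
    have := hi.le.trans (hgrow i)
    exact_mod_cast this
  classical
  set m := Nat.find hlarge with hm
  have hm12 : 12 ≤ |u m| := Nat.find_spec hlarge
  refine ⟨fun k => u (m + k), hm12, ?_, fun n => ?_⟩
  · rcases Nat.eq_zero_or_eq_succ_pred m with h0 | h0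
    · have h3 := hu 0
      simp only [Finset.range_zero, Finset.sum_empty, add_zero] at h3
      have h4 : |(u 0 : ℝ)| ≤ 3 := abs_le_of_sq_le_sq (by nlinarith) (by norm_num)
      have h5 : |u 0| ≤ 3 := by exact_mod_cast h4
      simp only [add_zero, h0]
      omega
    · have h3 : |u m.pred| < 12 := not_le.1 (Nat.find_min hlarge (by omega))
      have h3' : |(u m.pred : ℝ)| < 12 := by exact_mod_cast h3
      have h4 := hterm m.pred
      have h5 := abs_sub_abs_le_abs_sub (u (m.pred + 1) : ℝ) (θ * u m.pred)
      rw [abs_mul, abs_of_nonneg (by linarith : 0 ≤ θ)] at h5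
      have h6 : |(u (m.pred + 1) : ℝ)| ≤ 27 := by nlinarith [abs_nonneg (u m.pred : ℝ)]
      have h7 : |u (m.pred + 1)| ≤ 27 := by exact_mod_cast h6
      simp only [add_zero]
      rw [h0]
      exact h7
  · have h3 := hb (m + n)
    rw [Finset.sum_range_add] at h3
    have h4 : 0 ≤ ∑ k ∈ Finset.range m, ((u (k + 1) : ℝ) - θ * u k) ^ 2 :=
      Finset.sum_nonneg fun _ _ => sq_nonneg _
    exact (le_add_of_nonneg_left h4).trans h3

/-! ### Hankel determinants -/

/-- Hadamard's inequality. -/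
theorem Matrix.abs_det_le_prod_norm {n : ℕ} (M : Matrix (Fin n) (Fin n) ℝ) :
    |M.det| ≤ ∏ i, ‖WithLp.toLp 2 (M i)‖ := by
  have : Fact (Module.finrank ℝ (EuclideanSpace ℝ (Fin n)) = n) := ⟨by simp⟩
  set b := EuclideanSpace.basisFun (Fin n) ℝ with hb
  have h := b.toBasis.orientation.abs_volumeForm_apply_le fun i => WithLp.toLp 2 (M i)
  rw [Orientation.volumeForm_robust _ b rfl, Module.Basis.det_apply] at h
  convert h using 2
  rw [← Matrix.det_transpose]
  congr 1

/-- The Hankel matrix of a sequence. -/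
def hankel {A : Type*} (v : ℕ → A) (n : ℕ) : Matrix (Fin n) (Fin n) A :=
  Matrix.of fun i j => v (i + j)

/-- Subtract θ times the preceding row from each row but the first, then apply Hadamard's
inequality. -/
theorem abs_det_hankel_le (v : ℕ → ℝ) (θ : ℝ) (n : ℕ) :
    |(hankel v (n + 1)).det| ≤ (∑ j ∈ Finset.range (n + 1), |v j|) *
      ∏ i ∈ Finset.range n,
        √(∑ j ∈ Finset.range (n + 1), (v (i + j + 1) - θ * v (i + j)) ^ 2) := by
  set M : Matrix (Fin (n + 1)) (Fin (n + 1)) ℝ := Matrix.of fun i j =>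
    Fin.cases (v j) (fun i : Fin n => v (i + j + 1) - θ * v (i + j)) i with hM
  have hdet : (hankel v (n + 1)).det = M.det := by
    refine Matrix.det_eq_of_forall_row_eq_smul_add_pred (fun _ => θ) (fun j => ?_) fun i j => ?_
    · simp [hankel, hM]
    · simp [hankel, hM, show (i : ℕ) + 1 + j = i + j + 1 by ring]
  rw [hdet]
  refine M.abs_det_le_prod_norm.trans ?_
  rw [Fin.prod_univ_succ]
  refine mul_le_mul ?_ (le_of_eq ?_) (Finset.prod_nonneg fun _ _ => norm_nonneg _)
    (Finset.sum_nonneg fun _ _ => abs_nonneg _)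
  · rw [EuclideanSpace.norm_eq, Real.sqrt_le_left (Finset.sum_nonneg fun _ _ => abs_nonneg _),
      Finset.sum_range]
    simp only [hM, Matrix.of_apply, Fin.cases_zero, Real.norm_eq_abs]
    exact Finset.sum_sq_le_sq_sum_of_nonneg fun _ _ => abs_nonneg _
  · rw [Finset.prod_range]
    refine Finset.prod_congr rfl fun i _ => ?_
    rw [EuclideanSpace.norm_eq, Finset.sum_range]
    simp [hM]

/-- The first row grows at most like 3 ^ n, while the reduced rows have norms tending to 0; once
these are at most 1/6 the bound decays like (3/6) ^ n, and an integer below 1 in absolute value is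
0. -/
theorem exists_det_hankel_eq_zero {θ C : ℝ} (h0 : 0 ≤ θ) (h2 : θ ≤ 2) (v : ℕ → ℤ)
    (hv : ∀ n, ∑ k ∈ Finset.range n, ((v (k + 1) : ℝ) - θ * v k) ^ 2 ≤ C) :
    ∃ N, ∀ n ≥ N, (hankel v n).det = 0 := by
  set η : ℕ → ℝ := fun k => ((v (k + 1) : ℝ) - θ * v k) ^ 2 with hη
  have hC : 0 ≤ C := by simpa using hv 0
  have hηn : ∀ k, 0 ≤ η k := fun k => sq_nonneg _
  have hsum : Summable η := summable_of_sum_range_le hηn hv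
  have hshift : ∀ i n, ∑ j ∈ Finset.range n, η (i + j) ≤ C := fun i n => by
    have h3 := hv (i + n)
    rw [Finset.sum_range_add] at h3
    exact (le_add_of_nonneg_left (Finset.sum_nonneg fun k _ => hηn k)).trans h3
  set b : ℝ := max |(v 0 : ℝ)| (√C) with hb
  have hb0 : 0 ≤ b := (abs_nonneg _).trans (le_max_left _ _)
  have hgrow : ∀ k, |(v k : ℝ)| ≤ b * 3 ^ k := by
    intro k
    induction k with
    | zero => simp [hb]
    | succ k ih =>
      have h3 : |(v (k + 1) : ℝ) - θ * v k| ≤ b := by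
        refine le_trans ?_ (le_max_right _ _)
        refine Real.abs_le_sqrt ?_
        simpa using hshift k 1
      have h4 := abs_sub_abs_le_abs_sub (v (k + 1) : ℝ) (θ * v k)
      rw [abs_mul, abs_of_nonneg h0] at h4
      have h5 : θ * |(v k : ℝ)| ≤ 2 * (b * 3 ^ k) :=
        mul_le_mul h2 ih (abs_nonneg _) (by norm_num)
      have h6 : b ≤ b * 3 ^ k := le_mul_of_one_le_right hb0 (one_le_pow₀ (by norm_num))
      rw [pow_succ]
      linarith
  have hrow : ∀ n, ∑ j ∈ Finset.range n, |(v j : ℝ)| ≤ b * 3 ^ n := by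
    intro n
    induction n with
    | zero => simpa using hb0
    | succ n ih =>
      rw [Finset.sum_range_succ, pow_succ]
      have : 0 ≤ b * 3 ^ n := by positivity
      linarith [hgrow n]
  obtain ⟨I, hI⟩ : ∃ I, ∀ i ≥ I, ∀ n, ∑ j ∈ Finset.range n, η (i + j) ≤ (1 / 6) ^ 2 := by
    have hev := (tendsto_sum_nat_add η).eventually
      (gt_mem_nhds (by norm_num : (0 : ℝ) < (1 / 6) ^ 2))
    obtain ⟨I, hI⟩ := Filter.eventually_atTop.1 hev
    refine ⟨I, fun i hi n => le_trans ?_ (hI i hi).le⟩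
    have := ((summable_nat_add_iff i).2 hsum).sum_le_tsum (Finset.range n) (fun k _ => hηn _)
    simpa only [add_comm] using this
  set c : ℝ := max 1 (√C) with hc
  have hc1 : 1 ≤ c := le_max_left _ _
  have hprod : ∀ m n, ∏ i ∈ Finset.range (I + m), √(∑ j ∈ Finset.range n, η (i + j)) ≤
      c ^ I * (1 / 6) ^ m := by
    intro m n
    rw [Finset.prod_range_add]
    refine mul_le_mul ?_ ?_ (Finset.prod_nonneg fun _ _ => Real.sqrt_nonneg _) (by positivity)
    · refine (Finset.prod_le_prod (g := fun _ => c) (fun _ _ => Real.sqrt_nonneg _) fun i _ => ?_).trans_eq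
        (by simp)
      exact (Real.sqrt_le_sqrt (hshift i n)).trans (le_max_right _ _)
    · refine (Finset.prod_le_prod (g := fun _ => 1 / 6) (fun _ _ => Real.sqrt_nonneg _)
        fun i _ => ?_).trans_eq (by simp)
      exact (Real.sqrt_le_left (by norm_num)).2 (hI _ (by omega) n)
  have hlim : Filter.Tendsto (fun m : ℕ => b * 3 ^ (I + 1) * c ^ I * (1 / 2 : ℝ) ^ m)
      Filter.atTop (nhds 0) := by
    simpa using (tendsto_pow_atTop_nhds_zero_of_lt_one (by norm_num : (0 : ℝ) ≤ 1 / 2)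
      (by norm_num)).const_mul (b * 3 ^ (I + 1) * c ^ I)
  obtain ⟨m₀, hm₀⟩ := Filter.eventually_atTop.1
    (hlim.eventually (gt_mem_nhds (zero_lt_one' ℝ)))
  refine ⟨I + m₀ + 1, fun n hn => ?_⟩
  obtain ⟨m, rfl⟩ := Nat.exists_eq_add_of_le hn
  have hcast : ((hankel v (I + m₀ + 1 + m)).det : ℝ)
      = (hankel (fun k => (v k : ℝ)) (I + m₀ + 1 + m)).det := by
    rw [Int.cast_det]
    rfl
  have hlt : |((hankel v (I + m₀ + 1 + m)).det : ℝ)| < 1 := by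
    rw [hcast, show I + m₀ + 1 + m = I + (m₀ + m) + 1 by ring]
    refine ((abs_det_hankel_le _ θ _).trans ?_).trans_lt (hm₀ (m₀ + m) (by omega))
    refine (mul_le_mul (hrow _) (hprod (m₀ + m) _)
      (Finset.prod_nonneg fun _ _ => Real.sqrt_nonneg _) (by positivity)).trans_eq ?_
    rw [show (1 / 2 : ℝ) = 3 * (1 / 6) by norm_num, mul_pow,
      show I + (m₀ + m) + 1 = I + 1 + (m₀ + m) by ring, pow_add (3 : ℝ) (I + 1)]
    ring
  have : |(hankel v (I + m₀ + 1 + m)).det| < 1 := by exact_mod_cast hlt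
  exact Int.abs_lt_one_iff.1 this

/-! ### Kronecker's rationality criterion -/

/-- A Padé approximant of a power series at a vanishing Hankel determinant. -/
theorem exists_pade_of_det_hankel_eq_zero {v : ℕ → ℤ} {n : ℕ} (h : (hankel v n).det = 0) :
    ∃ c a : ℤ[X], c ≠ 0 ∧ c.natDegree ≤ n - 1 ∧ (a.natDegree ≤ n - 2) ∧
      PowerSeries.X ^ (2 * n - 1) ∣ (c : PowerSeries ℤ) * PowerSeries.mk v - (a : PowerSeries ℤ) := by
  obtain ⟨w, hw, hmul⟩ := Matrix.exists_mulVec_eq_zero_iff.2 h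
  -- The null vector is read in reverse, so that coefficient n - 1 + k of the product is row k of
  -- the Hankel matrix applied to w.
  set c : ℤ[X] := ∑ i : Fin n, monomial (n - 1 - i) (w i) with hc
  have hcoeff : ∀ i : Fin n, c.coeff (n - 1 - i) = w i := by
    intro i
    rw [hc, finsetSum_coeff, Finset.sum_eq_single i]
    · simp
    · intro j _ hj
      rw [coeff_monomial, if_neg]
      intro h3
      exact hj (Fin.ext (by omega))
    · simp
  have hdeg : c.natDegree ≤ n - 1 := natDegree_sum_le_of_forall_le _ _ fun i _ =>
    (natDegree_monomial_le _).trans (Nat.sub_le _ _)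
  set f := (c : PowerSeries ℤ) * PowerSeries.mk v with hf
  have hfk : ∀ k < n, PowerSeries.coeff (n - 1 + k) f = 0 := by
    intro k hk
    have h3 := congrFun hmul ⟨k, hk⟩
    simp only [Matrix.mulVec, dotProduct, hankel, Matrix.of_apply, Pi.zero_apply] at h3
    rw [← h3, hf, hc]
    rw [← Polynomial.coeToPowerSeries.ringHom_apply, map_sum, Finset.sum_mul, map_sum]
    refine Finset.sum_congr rfl fun i _ => ?_
    rw [Polynomial.coeToPowerSeries.ringHom_apply, ← C_mul_X_pow_eq_monomial, Polynomial.coe_mul,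
      Polynomial.coe_C, Polynomial.coe_pow, Polynomial.coe_X, mul_assoc, PowerSeries.coeff_C_mul, PowerSeries.coeff_X_pow_mul',
      if_pos (by omega), PowerSeries.coeff_mk, mul_comm]
    congr 2
    omega
  refine ⟨c, PowerSeries.trunc (n - 1) f, ?_, hdeg, ?_, ?_⟩
  · intro h3
    apply hw
    funext i
    rw [← hcoeff i, h3]
    simp
  · rw [natDegree_le_iff_coeff_eq_zero]
    intro k hk
    rw [PowerSeries.coeff_trunc, if_neg (by omega)]
  · rw [PowerSeries.X_pow_dvd_iff]
    intro k hk
    rw [map_sub, coeff_coe, PowerSeries.coeff_trunc]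
    split_ifs with h3
    · exact sub_self _
    · obtain ⟨j, rfl⟩ := Nat.exists_eq_add_of_le (not_lt.1 h3)
      rw [sub_zero, hfk j (by omega)]

theorem exists_rational_of_det_hankel_eq_zero {v : ℕ → ℤ} {N : ℕ}
    (h : ∀ n ≥ N, (hankel v n).det = 0) :
    ∃ c a : ℤ[X], c ≠ 0 ∧ (c : PowerSeries ℤ) * PowerSeries.mk v = a := by
  have hex : ∀ m, ∃ c a : ℤ[X], c ≠ 0 ∧ c.natDegree ≤ N + m + 1 ∧ a.natDegree ≤ N + m ∧
      PowerSeries.X ^ (2 * (N + m) + 3) ∣ (c : PowerSeries ℤ) * PowerSeries.mk v - (a : PowerSeries ℤ) := by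
    intro m
    have := exists_pade_of_det_hankel_eq_zero (h (N + m + 2) (by omega))
    simpa [show 2 * (N + m + 2) - 1 = 2 * (N + m) + 3 by omega] using this
  choose c a hc hcd had hdvd using hex
  set f := PowerSeries.mk v
  have hstep : ∀ m, c m * a (m + 1) = c (m + 1) * a m := by
    intro m
    -- The cross difference of consecutive approximants has degree at most 2(N + m) + 2, one too
    -- small for this divisibility unless it is 0.
    have h1 : PowerSeries.X ^ (2 * (N + m) + 3) ∣
        ((c (m + 1) * a m - c m * a (m + 1) : ℤ[X]) : PowerSeries ℤ) := by
      have h2 : PowerSeries.X ^ (2 * (N + m) + 3) ∣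
          (c (m + 1) : PowerSeries ℤ) * f - (a (m + 1) : PowerSeries ℤ) :=
        (pow_dvd_pow _ (by omega)).trans (hdvd (m + 1))
      have h3 := ((h2.mul_left (c m : PowerSeries ℤ)).sub
        ((hdvd m).mul_left (c (m + 1) : PowerSeries ℤ)))
      convert h3 using 1
      rw [Polynomial.coe_sub, Polynomial.coe_mul, Polynomial.coe_mul]
      ring
    rw [PowerSeries.X_pow_dvd_iff] at h1
    refine (sub_eq_zero.1 ?_).symm
    ext k
    rw [coeff_zero]
    rcases lt_or_ge k (2 * (N + m) + 3) with hk | hk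
    · rw [← h1 k hk, coeff_coe]
    · refine coeff_eq_zero_of_natDegree_lt (lt_of_le_of_lt ?_ hk)
      refine (natDegree_sub_le _ _).trans (max_le (natDegree_mul_le.trans ?_)
        (natDegree_mul_le.trans ?_) : _ ≤ 2 * (N + m) + 2)
      · have h4 := hcd (m + 1)
        have h5 := had m
        omega
      · have h4 := hcd m
        have h5 := had (m + 1)
        omega
  have hall : ∀ m, c 0 * a m = c m * a 0 := by
    intro m
    induction m with
    | zero => rfl
    | succ m ih =>
      refine mul_left_cancel₀ (hc m) ?_
      linear_combination c 0 * hstep m + c (m + 1) * ih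
  refine ⟨c 0, a 0, hc 0, sub_eq_zero.1 ?_⟩
  set D := (c 0 : PowerSeries ℤ) * f - (a 0 : PowerSeries ℤ)
  ext k
  have h1 : PowerSeries.X ^ (2 * (N + k) + 3) ∣ (c k : PowerSeries ℤ) * D := by
    have h2 := (hdvd k).mul_left (c 0 : PowerSeries ℤ)
    convert h2 using 1
    have h3 := congrArg (fun p : ℤ[X] => (p : PowerSeries ℤ)) (hall k)
    simp only [Polynomial.coe_mul] at h3
    linear_combination h3
  -- The factor `c k` has order at most N + k + 1, so D has order above k.
  have h2 := PowerSeries.nat_le_order _ _ (PowerSeries.X_pow_dvd_iff.1 h1)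
  rw [PowerSeries.order_mul] at h2
  have h3 : (c k : PowerSeries ℤ).order ≤ ((N + k + 1 : ℕ) : ℕ∞) := by
    refine (PowerSeries.order_le (c k).natDegree ?_).trans (by exact_mod_cast hcd k)
    rw [coeff_coe]
    exact leadingCoeff_ne_zero.2 (hc k)
  rw [map_zero]
  refine PowerSeries.coeff_of_lt_order k (lt_of_not_ge fun h4 => ?_)
  have h5 := h2.trans (add_le_add h3 h4)
  have h6 : 2 * (N + k) + 3 ≤ N + k + 1 + k := by exact_mod_cast h5
  omega

/-! ### Linear recurrences of integer sequences -/

/-- The shift operator on sequences. -/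
def seqShift (A : Type*) [CommRing A] : Module.End A (ℕ → A) where
  toFun v k := v (k + 1)
  map_add' _ _ := rfl
  map_smul' _ _ := rfl

theorem seqShift_pow_apply {A : Type*} [CommRing A] (v : ℕ → A) (i k : ℕ) :
    (seqShift A ^ i) v k = v (k + i) := by
  induction i generalizing k with
  | zero => simp
  | succ i ih =>
    rw [pow_succ', Module.End.mul_apply]
    change (seqShift A ^ i) v (k + 1) = _
    rw [ih]
    congr 1
    ring

theorem aeval_seqShift_apply {A : Type*} [CommRing A] (p : A[X]) (v : ℕ → A) (k : ℕ) :
    aeval (seqShift A) p v k = ∑ i ∈ Finset.range (p.natDegree + 1), p.coeff i * v (k + i) := by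
  rw [aeval_eq_sum_range]
  simp [seqShift_pow_apply]

/-- Fatou's lemma: an integer sequence with rational generating function satisfies a monic
integer linear recurrence. -/
theorem exists_monic_aeval_seqShift_eq_zero {v : ℕ → ℤ} {c a : ℤ[X]} (hc : c ≠ 0)
    (h : (c : PowerSeries ℤ) * PowerSeries.mk v = a) :
    ∃ r : ℤ[X], r.Monic ∧ aeval (seqShift ℤ) r v = 0 := by
  set D := c.natDegree + a.natDegree + 1 with hD
  set t := c.natTrailingDegree with ht
  have hct : c.coeff t ≠ 0 := by
    rw [ht, ← trailingCoeff]
    exact trailingCoeff_nonzero_iff_nonzero.2 hc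
  have htd : t ≤ c.natDegree := natTrailingDegree_le_natDegree c
  -- the recurrence, for indices past `D`
  have hrec : ∀ k ≥ D, ∑ i ∈ Finset.range (c.natDegree + 1), c.coeff i * v (k - i) = 0 := by
    intro k hk
    have h1 := congrArg (PowerSeries.coeff k) h
    rw [coeff_coe, coeff_eq_zero_of_natDegree_lt (by omega : a.natDegree < k),
      PowerSeries.coeff_mul, Finset.Nat.sum_antidiagonal_eq_sum_range_succ_mk] at h1
    simp only [coeff_coe, PowerSeries.coeff_mk] at h1
    rw [← h1]
    refine Finset.sum_subset (Finset.range_subset_range.2 (by omega)) fun i _ hi => ?_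
    rw [coeff_eq_zero_of_natDegree_lt (by simpa using hi), zero_mul]
  set V : Submodule ℤ (ℕ → ℤ) := Submodule.span ℤ (Set.range fun i => (seqShift ℤ ^ i) v) with hV
  have hvV : v ∈ V := Submodule.subset_span ⟨0, by simp⟩
  have hinv : ∀ w ∈ V, seqShift ℤ w ∈ V := by
    intro w hw
    have h1 : V.map (seqShift ℤ) ≤ V := by
      rw [hV, Submodule.map_span, Submodule.span_le]
      rintro _ ⟨_, ⟨i, rfl⟩, rfl⟩
      refine Submodule.subset_span ⟨i + 1, ?_⟩
      simp only [pow_succ', Module.End.mul_apply]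
    exact h1 ⟨w, hw, rfl⟩
  have hVrec : ∀ w ∈ V, ∀ k ≥ D,
      ∑ i ∈ Finset.range (c.natDegree + 1), c.coeff i * w (k - i) = 0 := by
    intro w hw
    induction hw using Submodule.span_induction with
    | mem w hw =>
      obtain ⟨j, rfl⟩ := hw
      intro k hk
      rw [← hrec (k + j) (by omega)]
      refine Finset.sum_congr rfl fun i hi => ?_
      rw [Finset.mem_range] at hi
      simp only [seqShift_pow_apply]
      congr 2
      omega
    | zero => simp
    | add x y _ _ hx hy =>
      intro k hk
      simp only [Pi.add_apply, mul_add, Finset.sum_add_distrib, hx k hk, hy k hk, add_zero]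
    | smul z x _ hx =>
      intro k hk
      have := hx k hk
      simp only [Pi.smul_apply, smul_eq_mul, mul_left_comm _ z, ← Finset.mul_sum, this, mul_zero]
  -- The lowest non-zero coefficient of c determines each later entry from earlier ones, so the
  -- first D entries determine a sequence in V. Hence V is finite over ℤ, and Cayley–Hamilton for
  -- the shift on V gives the monic recurrence.
  set φ : V →ₗ[ℤ] (Fin D → ℤ) := (LinearMap.funLeft ℤ ℤ (fun i : Fin D => (i : ℕ))).comp V.subtype
  have hφ : Function.Injective φ := by
    rw [injective_iff_map_eq_zero]
    rintro ⟨w, hw⟩ h0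
    ext k
    change w k = 0
    induction k using Nat.strong_induction_on with
    | _ k ih =>
      rcases lt_or_ge k D with hk | hk
      · exact congrFun h0 ⟨k, hk⟩
      · have h1 := hVrec w hw (k + t) (by omega)
        rw [Finset.sum_eq_single t] at h1
        · simpa [hct] using h1
        · intro i hi hit
          rcases lt_or_gt_of_ne hit with h2 | h2
          · rw [coeff_eq_zero_of_lt_natTrailingDegree h2, zero_mul]
          · rw [Finset.mem_range] at hi
            rw [ih (k + t - i) (by omega), mul_zero]
        · intro h2
          exact absurd (Finset.mem_range.2 (by omega)) h2
  have : Module.Finite ℤ V := Module.Finite.of_injective φ hφ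
  obtain ⟨r, hr, hr0⟩ := LinearMap.exists_monic_and_aeval_eq_zero ℤ ((seqShift ℤ).restrict hinv)
  refine ⟨r, hr, ?_⟩
  have hpow : ∀ i : ℕ, ((((seqShift ℤ).restrict hinv) ^ i) ⟨v, hvV⟩ : ℕ → ℤ)
      = (seqShift ℤ ^ i) v := by
    intro i
    rw [Module.End.pow_restrict]
    rfl
  have h1 := congrArg (fun g : Module.End ℤ V => ((g ⟨v, hvV⟩ : V) : ℕ → ℤ)) hr0
  simp only [aeval_eq_sum_range, LinearMap.sum_apply, LinearMap.smul_apply, LinearMap.zero_apply,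
    Submodule.coe_sum, Submodule.coe_smul, Submodule.coe_zero, hpow] at h1
  rw [aeval_eq_sum_range, LinearMap.sum_apply]
  exact h1

/-! ### A criterion for Pisot numbers -/

theorem tendsto_aeval_seqShift {v : ℕ → ℂ} (hv : Filter.Tendsto v Filter.atTop (nhds 0))
    (p : ℂ[X]) : Filter.Tendsto (aeval (seqShift ℂ) p v) Filter.atTop (nhds 0) := by
  have h : aeval (seqShift ℂ) p v
      = fun k => ∑ i ∈ Finset.range (p.natDegree + 1), p.coeff i * v (k + i) :=
    funext fun k => aeval_seqShift_apply p v k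
  rw [h, ← Finset.sum_const_zero (s := Finset.range (p.natDegree + 1))]
  refine tendsto_finsetSum _ fun i _ => ?_
  simpa using ((Filter.tendsto_add_atTop_iff_nat i).2 hv).const_mul (p.coeff i)

/-- An asymptotically geometric sequence that does not tend to zero: `p(S) v → 0` forces
`p` to vanish at the ratio. -/
theorem eval_eq_zero_of_tendsto_aeval_seqShift {v : ℕ → ℂ} {z : ℂ}
    (hz : Filter.Tendsto (aeval (seqShift ℂ) (X - C z) v) Filter.atTop (nhds 0))
    (hv : ¬ Filter.Tendsto v Filter.atTop (nhds 0)) {p : ℂ[X]}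
    (hp : Filter.Tendsto (aeval (seqShift ℂ) p v) Filter.atTop (nhds 0)) : p.eval z = 0 := by
  by_contra hne
  apply hv
  obtain ⟨q, hq⟩ := X_sub_C_dvd_sub_C_eval (a := z) (p := p)
  have h1 : aeval (seqShift ℂ) (C (p.eval z)) v = aeval (seqShift ℂ) p v
      - aeval (seqShift ℂ) q (aeval (seqShift ℂ) (X - C z) v) := by
    rw [← Module.End.mul_apply, ← map_mul, mul_comm q, ← hq, map_sub, LinearMap.sub_apply]
    abel
  have h2 : v = (p.eval z)⁻¹ • aeval (seqShift ℂ) (C (p.eval z)) v := by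
    rw [aeval_C, Module.algebraMap_end_apply, smul_smul, inv_mul_cancel₀ hne, one_smul]
  rw [h2, h1]
  have h3 := (hp.sub (tendsto_aeval_seqShift hz q)).const_smul (p.eval z)⁻¹
  rw [sub_zero, smul_zero] at h3
  exact h3

theorem aeval_seqShift_intCast (p : ℤ[X]) (v : ℕ → ℤ) (k : ℕ) :
    aeval (seqShift ℂ) (p.map (Int.castRingHom ℂ)) (fun k => (v k : ℂ)) k
      = ((aeval (seqShift ℤ) p v k : ℤ) : ℂ) := by
  rw [aeval_seqShift_apply, aeval_seqShift_apply,
    natDegree_map_eq_of_injective (RingHom.injective_int _)]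
  push_cast
  simp

/-- Pisot's criterion for sequences satisfying a monic integer recurrence. -/
theorem isPisot_of_recurrence {θ : ℝ} (h1 : 1 < θ) {v : ℕ → ℤ}
    (hη : Filter.Tendsto (fun k => (v (k + 1) : ℝ) - θ * v k) Filter.atTop (nhds 0))
    (hv : ∀ k, v k ≠ 0) {r : ℤ[X]} (hr : r.Monic) (hrv : aeval (seqShift ℤ) r v = 0) :
    IsPisot θ := by
  set w : ℕ → ℂ := fun k => (v k : ℂ) with hw
  have hw0 : ¬ Filter.Tendsto w Filter.atTop (nhds 0) := by
    intro h
    obtain ⟨k, hk⟩ := ((tendsto_zero_iff_norm_tendsto_zero.1 h).eventually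
      (gt_mem_nhds (zero_lt_one' ℝ))).exists
    simp only [hw, Complex.norm_intCast] at hk
    exact hv k (Int.abs_lt_one_iff.1 (by exact_mod_cast hk))
  have hηw : Filter.Tendsto (aeval (seqShift ℂ) (X - C (θ : ℂ)) w) Filter.atTop (nhds 0) := by
    have h2 := (Complex.continuous_ofReal.tendsto 0).comp hη
    rw [Complex.ofReal_zero] at h2
    refine h2.congr fun k => ?_
    simp only [Function.comp_apply, map_sub, aeval_X, aeval_C, LinearMap.sub_apply, Pi.sub_apply,
      Module.algebraMap_end_apply, Pi.smul_apply, smul_eq_mul]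
    push_cast
    rfl
  have hint : IsIntegral ℤ θ := by
    refine ⟨r, hr, ?_⟩
    have h2 : (r.map (Int.castRingHom ℂ)).eval (θ : ℂ) = 0 := by
      refine eval_eq_zero_of_tendsto_aeval_seqShift hηw hw0 ?_
      have : aeval (seqShift ℂ) (r.map (Int.castRingHom ℂ)) w = 0 := by
        funext k
        rw [hw, aeval_seqShift_intCast, hrv]
        simp
      rw [this]
      exact tendsto_const_nhds
    have h3 : (algebraMap ℝ ℂ) (eval₂ (algebraMap ℤ ℝ) θ r) = 0 := by
      rw [hom_eval₂, ← h2, eval_map]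
      congr 1
    exact (map_eq_zero _).1 h3
  refine ⟨h1, hint, fun z hz hzθ => ?_⟩
  set m := minpoly ℤ θ with hm
  have hmQ : minpoly ℚ θ = m.map (algebraMap ℤ ℚ) :=
    minpoly.isIntegrallyClosed_eq_field_fractions' ℚ hint
  have hintQ : IsIntegral ℚ θ := hint.tower_top
  have hirr := minpoly.irreducible hintQ
  set M : ℂ[X] := m.map (Int.castRingHom ℂ) with hM
  have hMQ : M = (minpoly ℚ θ).map (algebraMap ℚ ℂ) := by
    rw [hmQ, Polynomial.map_map]
    congr 1
  have hMz : M.IsRoot z := by rw [hMQ, IsRoot.def, eval_map_algebraMap, hz]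
  have hθQ : aeval (θ : ℂ) (minpoly ℚ θ) = 0 := by
    have h := congrArg (algebraMap ℝ ℂ) (minpoly.aeval ℚ θ)
    rw [map_zero, ← Polynomial.aeval_algebraMap_apply] at h
    exact h
  have hMθ : M.IsRoot (θ : ℂ) := by rw [hMQ, IsRoot.def, eval_map_algebraMap, hθQ]
  -- the sequence eventually satisfies the recurrence of the minimal polynomial
  obtain ⟨K, hK⟩ : ∃ K, ∀ k ≥ K, aeval (seqShift ℂ) M w k = 0 := by
    obtain ⟨q, hq⟩ := dvd_iff_isRoot.2 hMθ
    have h2 : Filter.Tendsto (aeval (seqShift ℂ) M w) Filter.atTop (nhds 0) := by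
      rw [hq, mul_comm, map_mul, Module.End.mul_apply]
      exact tendsto_aeval_seqShift hηw q
    obtain ⟨K, hK⟩ := Filter.eventually_atTop.1 ((tendsto_zero_iff_norm_tendsto_zero.1 h2).eventually
      (gt_mem_nhds (zero_lt_one' ℝ)))
    refine ⟨K, fun k hk => ?_⟩
    have h3 := hK k hk
    rw [hM, hw, aeval_seqShift_intCast, Complex.norm_intCast] at h3
    have h4 : aeval (seqShift ℤ) m v k = 0 := Int.abs_lt_one_iff.1 (by exact_mod_cast h3)
    rw [hM, hw, aeval_seqShift_intCast, h4, Int.cast_zero]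
  -- dividing by one linear factor leaves a geometric sequence
  set q : ℂ → ℂ[X] := fun y => M /ₘ (X - C y) with hq
  have hgeom : ∀ y, M.IsRoot y → ∀ j, aeval (seqShift ℂ) (q y) w (K + j)
      = aeval (seqShift ℂ) (q y) w K * y ^ j := by
    intro y hy j
    induction j with
    | zero => simp
    | succ j ih =>
      have h2 := hK (K + j) (by omega)
      rw [← mul_divByMonic_eq_iff_isRoot.2 hy, map_mul, Module.End.mul_apply] at h2
      simp only [map_sub, aeval_X, aeval_C, LinearMap.sub_apply, Pi.sub_apply,
        Module.algebraMap_end_apply, Pi.smul_apply, smul_eq_mul] at h2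
      rw [pow_succ, ← mul_assoc, ← ih, ← add_assoc]
      have h3 := sub_eq_zero.1 h2
      rw [mul_comm] at h3
      exact h3
  -- the coefficient of the geometric sequence is a polynomial in the root
  set G : ℚ[X] := ∑ n ∈ Finset.range (m.natDegree + 1), ∑ i ∈ Finset.Icc (n + 1) m.natDegree,
    X ^ (i - (n + 1)) * C ((m.coeff i : ℚ) * (v (K + n) : ℚ)) with hG
  have hMdeg : M.natDegree = m.natDegree := natDegree_map_eq_of_injective (RingHom.injective_int _) _
  have hcoef : ∀ y, aeval (seqShift ℂ) (q y) w K = aeval y G := by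
    intro y
    have h2 : aeval (seqShift ℂ) (q y) w K
        = ∑ n ∈ Finset.range (m.natDegree + 1), (q y).coeff n * w (K + n) := by
      rw [aeval_seqShift_apply]
      refine Finset.sum_subset (Finset.range_subset_range.2 ?_) fun i _ hi => ?_
      · have : (q y).natDegree = M.natDegree - (X - C y).natDegree :=
          natDegree_divByMonic _ (monic_X_sub_C y)
        omega
      · rw [coeff_eq_zero_of_natDegree_lt (by simpa using hi), zero_mul]
    rw [h2, hG, map_sum]
    refine Finset.sum_congr rfl fun n _ => ?_
    rw [map_sum, hq, coeff_divByMonic_X_sub_C, hMdeg, Finset.sum_mul]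
    refine Finset.sum_congr rfl fun i _ => ?_
    simp [hM, hw, mul_assoc]
  -- A rational polynomial vanishing at z also vanishes at its conjugate θ. Then `q θ` applied to
  -- the sequence tends to 0, so M' vanishes at θ, against separability.
  have hcz : aeval (seqShift ℂ) (q z) w K ≠ 0 := by
    intro h2
    rw [hcoef] at h2
    have h3 : minpoly ℚ θ ∣ G := by
      rw [minpoly.eq_of_irreducible_of_monic hirr hz (minpoly.monic hintQ)]
      exact minpoly.dvd ℚ z h2
    obtain ⟨g, hg⟩ := h3
    have h4 : aeval (θ : ℂ) G = 0 := by rw [hg, map_mul, hθQ, zero_mul]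
    have h5 : Filter.Tendsto (aeval (seqShift ℂ) (q θ) w) Filter.atTop (nhds 0) := by
      refine tendsto_const_nhds.congr' (Filter.eventually_atTop.2 ⟨K, fun k hk => ?_⟩)
      obtain ⟨j, rfl⟩ := Nat.exists_eq_add_of_le hk
      rw [hgeom _ hMθ, hcoef, h4, zero_mul]
    have h6 := eval_eq_zero_of_tendsto_aeval_seqShift hηw hw0 h5
    have h7 : (derivative M).eval (θ : ℂ) = 0 := by
      rw [← mul_divByMonic_eq_iff_isRoot.2 hMθ, derivative_mul]
      simp only [derivative_sub, derivative_X, derivative_C, sub_zero, one_mul, eval_add, eval_mul,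
        eval_sub, eval_X, eval_C, sub_self, zero_mul, add_zero]
      exact h6
    have hsep : M.Separable := hMQ ▸ hirr.separable.map
    exact hsep.eval₂_derivative_ne_zero (RingHom.id ℂ) (by simpa [eval₂_id] using hMθ)
      (by simpa [eval₂_id] using h7)
  -- Since X - θ divides `q z`, the geometric sequence of ratio z tends to 0; its coefficient is
  -- non-zero, so ‖z‖ < 1.
  have hdvd : (q z).IsRoot (θ : ℂ) := by
    have h2 := hMθ
    rw [← mul_divByMonic_eq_iff_isRoot.2 hMz, IsRoot.def, eval_mul] at h2
    refine (mul_eq_zero.1 h2).resolve_left ?_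
    simpa [sub_eq_zero] using Ne.symm hzθ
  have hlim : Filter.Tendsto (aeval (seqShift ℂ) (q z) w) Filter.atTop (nhds 0) := by
    obtain ⟨g, hg⟩ := dvd_iff_isRoot.2 hdvd
    rw [hg, mul_comm, map_mul, Module.End.mul_apply]
    exact tendsto_aeval_seqShift hηw g
  have hpow : Filter.Tendsto (fun j : ℕ => z ^ j) Filter.atTop (nhds 0) := by
    have h2 := ((Filter.tendsto_add_atTop_iff_nat K).2 hlim).const_mul
      (aeval (seqShift ℂ) (q z) w K)⁻¹
    rw [mul_zero] at h2
    refine h2.congr fun j => ?_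
    rw [add_comm, hgeom z hMz, ← mul_assoc, inv_mul_cancel₀ hcz, one_mul]
  exact tendsto_pow_atTop_nhds_zero_iff_norm_lt_one.1 hpow

/-- The start at 12 persists: errors are at most 3 and (3/2) · 12 - 3 ≥ 12, so no term vanishes. -/
theorem isPisot_of_seq {θ : ℝ} (h1 : 3 / 2 ≤ θ) (h2 : θ ≤ 2) {v : ℕ → ℤ} (hv0 : 12 ≤ |v 0|)
    (hv : ∀ n, ∑ k ∈ Finset.range n, ((v (k + 1) : ℝ) - θ * v k) ^ 2 ≤ 5) : IsPisot θ := by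
  obtain ⟨N, hN⟩ := exists_det_hankel_eq_zero (by linarith) h2 v hv
  obtain ⟨c, a, hc, hca⟩ := exists_rational_of_det_hankel_eq_zero hN
  obtain ⟨r, hr, hrv⟩ := exists_monic_aeval_seqShift_eq_zero hc hca
  have hsum : Summable fun k => ((v (k + 1) : ℝ) - θ * v k) ^ 2 :=
    summable_of_sum_range_le (fun _ => sq_nonneg _) hv
  have hη : Filter.Tendsto (fun k => (v (k + 1) : ℝ) - θ * v k) Filter.atTop (nhds 0) := by
    have h3 := (Real.continuous_sqrt.tendsto 0).comp hsum.tendsto_atTop_zero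
    simp only [Function.comp_def, Real.sqrt_sq_eq_abs, Real.sqrt_zero] at h3
    exact (tendsto_zero_iff_abs_tendsto_zero _).2 h3
  have hlarge : ∀ k, (12 : ℝ) ≤ |(v k : ℝ)| := by
    intro k
    induction k with
    | zero => exact_mod_cast hv0
    | succ k ih =>
      have h3 := hv (k + 1)
      rw [Finset.sum_range_succ] at h3
      have h4 : 0 ≤ ∑ k ∈ Finset.range k, ((v (k + 1) : ℝ) - θ * v k) ^ 2 :=
        Finset.sum_nonneg fun _ _ => sq_nonneg _
      have h5 : |(v (k + 1) : ℝ) - θ * v k| ≤ 3 :=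
        abs_le_of_sq_le_sq (by linarith) (by norm_num)
      have h6 := abs_sub_abs_le_abs_sub (θ * (v k : ℝ)) (v (k + 1))
      rw [abs_sub_comm, abs_mul, abs_of_nonneg (by linarith : 0 ≤ θ)] at h6
      nlinarith
  refine isPisot_of_recurrence (by linarith) hη (fun k hk => ?_) hr hrv
  have := hlarge k
  rw [hk] at this
  norm_num at this

/-- Limits of Pisot numbers in `[3/2, 2)` are Pisot numbers. -/
theorem isPisot_of_ultrafilter {θ : ℝ} (h1 : 3 / 2 ≤ θ) (h2 : θ ≤ 2) (F : Ultrafilter ℝ)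
    (hF : (F : Filter ℝ) ≤ nhds θ) (hP : ∀ᶠ β in F, IsPisot β ∧ 3 / 2 ≤ β ∧ β < 2) :
    IsPisot θ := by
  have hex : ∀ β : ℝ, ∃ u : ℕ → ℤ, IsPisot β ∧ 3 / 2 ≤ β ∧ β < 2 → 12 ≤ |u 0| ∧ |u 0| ≤ 27 ∧
      ∀ n, ∑ k ∈ Finset.range n, ((u (k + 1) : ℝ) - β * u k) ^ 2 ≤ 5 := by
    intro β
    by_cases h : IsPisot β ∧ 3 / 2 ≤ β ∧ β < 2
    · obtain ⟨u, hu⟩ := h.1.exists_seq_large h.2.1 h.2.2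
      exact ⟨u, fun _ => hu⟩
    · exact ⟨0, fun h' => absurd h' h⟩
  choose u hu using hex
  have hbd : ∀ β, IsPisot β ∧ 3 / 2 ≤ β ∧ β < 2 → ∀ k, |u β k| ≤ 27 * 3 ^ k := by
    intro β hβ k
    obtain ⟨-, h0, hs⟩ := hu β hβ
    suffices h : |(u β k : ℝ)| ≤ 27 * 3 ^ k by exact_mod_cast h
    induction k with
    | zero => simpa using (by exact_mod_cast h0 : |(u β 0 : ℝ)| ≤ 27)
    | succ k ih =>
      have h3 := hs (k + 1)
      rw [Finset.sum_range_succ] at h3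
      have h4 : 0 ≤ ∑ i ∈ Finset.range k, ((u β (i + 1) : ℝ) - β * u β i) ^ 2 :=
        Finset.sum_nonneg fun _ _ => sq_nonneg _
      have h5 : |(u β (k + 1) : ℝ) - β * u β k| ≤ 3 :=
        abs_le_of_sq_le_sq (by linarith) (by norm_num)
      have h6 := abs_sub_abs_le_abs_sub (u β (k + 1) : ℝ) (β * u β k)
      rw [abs_mul, abs_of_nonneg (by linarith [hβ.2.1] : 0 ≤ β)] at h6
      have h7 : β * |(u β k : ℝ)| ≤ 2 * (27 * 3 ^ k) :=
        mul_le_mul hβ.2.2.le ih (abs_nonneg _) (by norm_num)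
      have h8 : (1 : ℝ) ≤ 3 ^ k := one_le_pow₀ (by norm_num)
      rw [pow_succ]
      linarith
  have hlim : ∀ k, ∃ d, ∀ᶠ β in F, u β k = d := fun k =>
    F.exists_eventually_eq_of_bounded _ _ (hP.mono fun β hβ => hbd β hβ k)
  choose v hv using hlim
  refine isPisot_of_seq h1 h2 (v := v) ?_ fun n => ?_
  · obtain ⟨β, hβ, h0⟩ := (hP.and (hv 0)).exists
    rw [← h0]
    exact (hu β hβ).1
  · have hcont : Continuous fun β : ℝ =>
        ∑ k ∈ Finset.range n, ((v (k + 1) : ℝ) - β * v k) ^ 2 := by fun_prop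
    refine le_of_tendsto ((hcont.tendsto θ).mono_left hF) ?_
    have hall : ∀ᶠ β in F, ∀ k < n + 1, u β k = v k :=
      (Filter.eventually_all_finite (Set.finite_Iio (n + 1))).2 fun k _ => hv k
    filter_upwards [hP, hall] with β hβ ha
    refine le_of_eq_of_le (Finset.sum_congr rfl fun k hk => ?_) ((hu β hβ).2.2 n)
    rw [Finset.mem_range] at hk
    rw [ha k (by omega), ha (k + 1) (by omega)]

/-! ### A univoque Pisot number -/

theorem isPisot_of_quartic {x y : ℝ} (hx1 : 1.9 < x) (hx2 : x < 1.91) (hy1 : 0.66 < y)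
    (hy2 : y < 0.68) (hx : x ^ 4 - x ^ 3 - 2 * x ^ 2 + 1 = 0)
    (hy : y ^ 4 - y ^ 3 - 2 * y ^ 2 + 1 = 0) : IsPisot x := by
  have hint : IsIntegral ℤ x := by
    refine ⟨X ^ 4 - X ^ 3 - 2 * X ^ 2 + 1, by monicity!, ?_⟩
    simpa [eval₂_add, eval₂_sub, eval₂_mul] using hx
  refine ⟨by linarith, hint, fun z hz hzx => ?_⟩
  have hdvd : minpoly ℚ x ∣ X ^ 4 - X ^ 3 - C 2 * X ^ 2 + 1 := by
    refine minpoly.dvd ℚ x ?_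
    simpa using hx
  obtain ⟨g, hg⟩ := hdvd
  have hz4 : z ^ 4 - z ^ 3 - 2 * z ^ 2 + 1 = 0 := by
    have h := congrArg (aeval z) hg
    rw [map_mul, hz, zero_mul] at h
    simpa using h
  have hq : y ^ 3 + (x - 1) * y ^ 2 + (x ^ 2 - x - 2) * y + (x ^ 3 - x ^ 2 - 2 * x) = 0 := by
    have h : (y - x) * (y ^ 3 + (x - 1) * y ^ 2 + (x ^ 2 - x - 2) * y
        + (x ^ 3 - x ^ 2 - 2 * x)) = 0 := by linear_combination hy - hx
    exact (mul_eq_zero.1 h).resolve_left (by intro h; linarith)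
  -- Dividing the quartic by its real roots x and y leaves z² + az + b, whose roots are non-real of
  -- squared modulus b < 1. Irreducibility of the quartic is not needed.
  set a : ℝ := x + y - 1 with ha
  set b : ℝ := x ^ 2 + x * y + y ^ 2 - x - y - 2 with hb
  have hb1 : b < 1 := by nlinarith
  have hab : a ^ 2 < 4 * b := by nlinarith
  have hxC : (x : ℂ) ^ 4 - x ^ 3 - 2 * x ^ 2 + 1 = 0 := by exact_mod_cast hx
  have hqC : (y : ℂ) ^ 3 + (x - 1) * y ^ 2 + (x ^ 2 - x - 2) * y + (x ^ 3 - x ^ 2 - 2 * x) = 0 := by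
    exact_mod_cast hq
  have hfac : (z - x) * ((z - y) * (z ^ 2 + a * z + b)) = 0 := by
    rw [ha, hb]
    push_cast
    linear_combination hz4 - hxC - (z - x) * hqC
  rcases mul_eq_zero.1 ((mul_eq_zero.1 hfac).resolve_left (sub_ne_zero.2 hzx)) with h | h
  · rw [sub_eq_zero.1 h, Complex.norm_real, Real.norm_eq_abs, abs_of_pos (by linarith)]
    linarith
  · have hre := congrArg Complex.re h
    have him := congrArg Complex.im h
    simp only [pow_two, Complex.add_re, Complex.add_im, Complex.mul_re, Complex.mul_im,
      Complex.ofReal_re, Complex.ofReal_im, Complex.zero_re, Complex.zero_im] at hre him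
    have hn : ‖z‖ ^ 2 < 1 := by
      rw [← Complex.normSq_eq_norm_sq, Complex.normSq_apply]
      have h3 : z.im * (2 * z.re + a) = 0 := by linear_combination him
      rcases mul_eq_zero.1 h3 with h4 | h4
      · rw [h4] at hre
        nlinarith [sq_nonneg (2 * z.re + a)]
      · nlinarith
    nlinarith [norm_nonneg z]

theorem mem_univoqueSet_of_quartic {x : ℝ} (hx1 : 1.9 < x) (hx2 : x < 1.91)
    (hx : x ^ 4 - x ^ 3 - 2 * x ^ 2 + 1 = 0) : x ∈ univoqueSet := by
  have h1 : 1 < x := by linarith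
  have h2 : x < 2 := by linarith
  -- The expansion is 11(10)^∞; the quartic equation says precisely that the orbit has period 2 from
  -- time 2 on.
  set s : ℕ → ℤ := fun k => if k = 1 ∨ Even k then 1 else 0 with hs
  have hpair : ∀ j, digitOrbit x s 1 (2 * j + 2) = x ^ 2 - x - 1 ∧
      digitOrbit x s 1 (2 * j + 3) = x ^ 3 - x ^ 2 - x - 1 := by
    have hstep : ∀ j, digitOrbit x s 1 (2 * j + 2) = x ^ 2 - x - 1 →
        digitOrbit x s 1 (2 * j + 3) = x ^ 3 - x ^ 2 - x - 1 := by
      intro j hj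
      have : s (2 * j + 2) = 1 := by simp [hs, parity_simps]
      rw [digitOrbit, hj, this]
      push_cast
      ring
    intro j
    induction j with
    | zero =>
      have h0 : digitOrbit x s 1 (2 * 0 + 2) = x ^ 2 - x - 1 := by
        simp [digitOrbit, hs]
        ring
      exact ⟨h0, hstep 0 h0⟩
    | succ j ih =>
      have h0 : digitOrbit x s 1 (2 * (j + 1) + 2) = x ^ 2 - x - 1 := by
        have : s (2 * j + 3) = 0 := by
          simp [hs, parity_simps]
        rw [show 2 * (j + 1) + 2 = 2 * j + 3 + 1 by ring, digitOrbit, ih.2, this]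
        push_cast
        linear_combination hx
      exact ⟨h0, hstep _ h0⟩
  have hcases : ∀ k, (digitOrbit x s 1 k = 1 ∧ s k = 1) ∨ (digitOrbit x s 1 k = x - 1 ∧ s k = 1) ∨
      (digitOrbit x s 1 k = x ^ 2 - x - 1 ∧ s k = 1) ∨
      (digitOrbit x s 1 k = x ^ 3 - x ^ 2 - x - 1 ∧ s k = 0) := by
    intro k
    rcases k with _ | _ | k
    · left
      simp [digitOrbit, hs]
    · right; left
      simp [digitOrbit, hs]
    · rcases Nat.even_or_odd' k with ⟨j, rfl | rfl⟩
      · right; right; left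
        exact ⟨(hpair j).1, by simp [hs, parity_simps]⟩
      · right; right; right
        refine ⟨(hpair j).2, ?_⟩
        simp [hs, parity_simps]
  have hb1 : 0.71 < x ^ 2 - x - 1 := by nlinarith
  have hb2 : x ^ 2 - x - 1 < 0.74 := by nlinarith
  have hc : x ^ 3 - x ^ 2 - x - 1 = x * (x ^ 2 - x - 1) - 1 := by ring
  have hc1 : 0.34 < x ^ 3 - x ^ 2 - x - 1 := by rw [hc]; nlinarith
  have hc2 : x ^ 3 - x ^ 2 - x - 1 < 0.42 := by rw [hc]; nlinarith
  have hadm : IsAdmissible x s 1 := by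
    refine ⟨fun k => ?_, fun k => ?_⟩
    · rcases hcases k with h | h | h | h <;> simp [h.2]
    · rcases hcases k with h | h | h | h <;> rw [h.1] <;> constructor <;> nlinarith
  refine ⟨⟨h1, h2⟩, AvoidsSwitch.isUnivoque h1 h2 hadm fun k => ?_⟩
  have hxx : 1.7 < (x - 1) * x := by nlinarith
  rcases hcases k with h | h | h | h <;> rw [h.1, h.2]
  · exact ⟨by simp, fun _ => by linarith⟩
  · exact ⟨by simp, fun _ => by nlinarith⟩
  · exact ⟨by simp, fun _ => by nlinarith⟩
  · exact ⟨fun _ => by nlinarith, by simp⟩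

theorem exists_isPisot_mem_univoqueSet : ∃ x, IsPisot x ∧ x ∈ univoqueSet := by
  have hcont : Continuous fun x : ℝ => x ^ 4 - x ^ 3 - 2 * x ^ 2 + 1 := by fun_prop
  obtain ⟨x, ⟨hx1, hx2⟩, hx⟩ := intermediate_value_Ioo (by norm_num : (1.9 : ℝ) ≤ 1.91)
    hcont.continuousOn (show (0 : ℝ) ∈ Set.Ioo _ _ by constructor <;> norm_num)
  obtain ⟨y, ⟨hy1, hy2⟩, hy⟩ := intermediate_value_Ioo' (by norm_num : (0.66 : ℝ) ≤ 0.68)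
    hcont.continuousOn (show (0 : ℝ) ∈ Set.Ioo _ _ by constructor <;> norm_num)
  exact ⟨x, isPisot_of_quartic hx1 hx2 hy1 hy2 hx hy, mem_univoqueSet_of_quartic hx1 hx2 hx⟩

theorem mainTheorem2 :
    ∃ θ : ℝ, IsLeast {β : ℝ | IsPisot β ∧ β ∈ univoqueSet} θ := by
  set A : Set ℝ := {β : ℝ | IsPisot β ∧ β ∈ univoqueSet} with hA
  have hlow : ∀ β ∈ A, 3 / 2 ≤ β := by
    intro β hβ
    have h1 := one_lt_of_mem_univoqueSet hβ.2
    have h2 := hβ.1.1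
    nlinarith
  have hne : A.Nonempty := exists_isPisot_mem_univoqueSet
  have hbdd : BddBelow A := ⟨3 / 2, hlow⟩
  have hglb := isGLB_csInf hne hbdd
  refine ⟨sInf A, ?_, hglb.1⟩
  -- If θ is not in A, all of A lies strictly above θ, as the limit from the right requires.
  by_contra hθ
  set θ := sInf A
  have h1 : 3 / 2 ≤ θ := hglb.2 hlow
  have h2 : θ < 2 := by
    obtain ⟨β, hβ⟩ := hne
    exact (hglb.1 hβ).trans_lt hβ.2.1.2
  have hclos : θ ∈ closure A := hglb.mem_closure hne
  have hbot : (nhdsWithin θ A).NeBot := mem_closure_iff_nhdsWithin_neBot.1 hclos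
  set F := Ultrafilter.of (nhdsWithin θ A)
  have hF : (F : Filter ℝ) ≤ nhdsWithin θ A := Ultrafilter.of_le _
  have hFA : ∀ᶠ β in F, β ∈ A := hF self_mem_nhdsWithin
  have hFn : (F : Filter ℝ) ≤ nhds θ := hF.trans nhdsWithin_le_nhds
  refine hθ ⟨isPisot_of_ultrafilter h1 h2.le F hFn ?_, ⟨by linarith, h2⟩,
    isUnivoque_of_ultrafilter (by linarith) h2 F hFn ?_ (hFA.mono fun β hβ => hβ.2)⟩
  · exact hFA.mono fun β hβ => ⟨hβ.1, hlow β hβ, hβ.2.1.2⟩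
  · exact hFA.mono fun β hβ => (hglb.1 hβ).lt_of_ne fun h => hθ (h ▸ hβ)
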